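/- **Nonlocal NLS hierarchies.** Throughout, $*$ denotes (entrywise) complex conjugation. For functions $q,r$ of $x$ let $$L=\begin{pmatrix}-\partial_x+2q\,\partial_x^{-1}r & 2q\,\partial_x^{-1}q\\ -2r\,\partial_x^{-1}r & \partial_x-2r\,\partial_x^{-1}q\end{pmatrix},\qquad K_m=\begin{pmatrix}K_{m,1}\\K_{m,2}\end{pmatrix}=L^m\begin{pmatrix}-q\\ r\end{pmatrix}\quad(m\ge 0),$$ where $K_{m,1},K_{m,2}$ are differential polynomials in $q,r$ and $\partial_x^{-1}$ of a total derivative is its primitive without constant term; thus $(q,r)^T_{t_m}=K_m$ is the AKNS hierarchy. For $k\ge1$ let $K_k^{\pm}[q(x),q(-x)]$ be the result of substituting $r(x)=\pm q^*(-x)$ into $-K_{2k,1}$. The nonlocal defocusing ($+$) and focusing ($-$) NLS hierarchies are $$iq_{\tau_{2k}}=K_k^{\pm}[q(x),q(-x)],\qquad k=1,2,3,\dots,\quad x,\tau_{2k}\in\mathbb R,$$ e.g. $K_1^{\pm}=q_{xx}\mp2q(x)^2q^*(-x)$. (They arise from the AKNS systems of even order $2k$ by $r(x)=\pm q^*(-x)$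 and the substitution of $i\tau_{2k}$ for the time of order $2k$.) **Theorem.** Let $n\ge0$, let $A,T$ be constant complex $(2n+2)\times(2n+2)$ matrices and $C,\overline C\in\mathbb C^{2n+2}$ constant vectors such that $$AT=TA^*,\qquad TT^*=\delta I,\qquad \overline C=TC^*,\qquad \delta=\mp1 .$$ Let $\tau=(\tau_2,\tau_4,\dots)$ be real numbers, put $t_{2j}=-2^{2j-1}i\tau_{2j}$, suppose that $\sum_{j\ge1}A^{2j}t_{2j}$ converges absolutely (for instance, that only finitely many $\tau_{2j}$ are non-zero), and let $$\varphi=\exp\Bigl(Ax+\sum_{j=1}^{\infty}A^{2j}t_{2j}\Bigr)C,\qquad \psi=\exp\Bigl(-Ax-\sum_{j=1}^{\infty}A^{2j}t_{2j}\Bigr)\overline C .$$ Write $|\widehat\varphi^{(a)};\widehat\psi^{(b)}|=\det(\varphi,\partial_x\varphi,\dots,\partial_x^{a}\varphi;\psi,\partial_x\psi,\dots,\partial_x^{b}\psi)$ for $a+b=2n$ (no column of $\varphi$, respectively $\psi$, if $a=-1$, respectively $b=-1$), and put $$q=2\,\frac{|\widehat\varphi^{(n+1)};\widehat\psi^{(n-1)}|}{|\widehat\varphi^{(n)};\widehat\psi^{(n)}|},\qquad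 r=-2\,\frac{|\widehat\varphi^{(n-1)};\widehat\psi^{(n+1)}|}{|\widehat\varphi^{(n)};\widehat\psi^{(n)}|}.$$ Then $\psi(x)=T\varphi^*(-x)$ for all $x\in\mathbb R$ and, at every point where $|\widehat\varphi^{(n)};\widehat\psi^{(n)}|\ne0$, one has $r(x)=\pm q^*(-x)$ and, for every $k\ge1$, $q$ is smooth in $(x,\tau_{2k})$ near the points with space coordinates $x$ and $-x$ and satisfies $iq_{\tau_{2k}}=K_k^{\pm}[q(x),q(-x)]$. Here the upper signs ($\delta=-1$, $K_k^+$) belong together, and so do the lower ones ($\delta=1$, $K_k^-$). -/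

import Mathlib

open scoped ContDiff

noncomputable section

namespace NonlocalNLS

/-! ### The AKNS hierarchy as a sequence of differential polynomials -/

/-- Differential polynomials in two functions `q`, `r` of `x`:
`Sum.inl j` stands for `∂ₓ^j q` and `Sum.inr j` for `∂ₓ^j r`. -/
abbrev DiffPoly : Type := MvPolynomial (ℕ ⊕ ℕ) ℂ

/-- The indeterminate `q`. -/
def qVar : DiffPoly := MvPolynomial.X (Sum.inl 0)

/-- The indeterminate `r`. -/
def rVar : DiffPoly := MvPolynomial.X (Sum.inr 0)

/-- The total derivative `∂ₓ`, with `∂ₓ (∂ₓ^j q) = ∂ₓ^(j+1) q`, and likewise for `r`. -/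
def dx : Derivation ℂ DiffPoly DiffPoly :=
  MvPolynomial.mkDerivation ℂ
    (Sum.elim (fun j => MvPolynomial.X (Sum.inl (j + 1)))
      (fun j => MvPolynomial.X (Sum.inr (j + 1))))

open Classical in
/-- The formal inverse `∂ₓ⁻¹`: the primitive of `p` with zero constant term (the only one, see
`eq_of_dx_eq`), and `0` if `p` is not a total derivative. -/
def dxInv (p : DiffPoly) : DiffPoly :=
  if h : ∃ w : DiffPoly, MvPolynomial.constantCoeff w = 0 ∧ dx w = p then h.choose else 0

section

open MvPolynomial

theorem pderiv_dx_inl (j : ℕ) (w : DiffPoly) :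
    pderiv (Sum.inl (j+1)) (dx w) = dx (pderiv (Sum.inl (j+1)) w) + pderiv (Sum.inl j) w := by
  induction w using MvPolynomial.induction_on with
  | C a => simp [dx]
  | add p q hp hq => simp only [map_add, hp, hq]; ring
  | mul_X p i hp =>
    have h : pderiv (Sum.inl (j+1)) (dx (X i)) = (pderiv (Sum.inl j) (X i) : DiffPoly) := by
      rcases i with i | i <;> simp [dx, pderiv_X, Pi.single_apply]
    have h2 : dx (pderiv (Sum.inl (j+1)) (X i : DiffPoly)) = 0 := by
      rw [pderiv_X]; by_cases hi : i = Sum.inl (j+1) <;> simp [hi]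
    simp only [Derivation.leibniz, map_add, hp, smul_eq_mul, h, h2]; ring
theorem pderiv_dx_inr (j : ℕ) (w : DiffPoly) :
    pderiv (Sum.inr (j+1)) (dx w) = dx (pderiv (Sum.inr (j+1)) w) + pderiv (Sum.inr j) w := by
  induction w using MvPolynomial.induction_on with
  | C a => simp [dx]
  | add p q hp hq => simp only [map_add, hp, hq]; ring
  | mul_X p i hp =>
    have h : pderiv (Sum.inr (j+1)) (dx (X i)) = (pderiv (Sum.inr j) (X i) : DiffPoly) := by
      rcases i with i | i <;> simp [dx, pderiv_X, Pi.single_apply]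
    have h2 : dx (pderiv (Sum.inr (j+1)) (X i : DiffPoly)) = 0 := by
      rw [pderiv_X]; by_cases hi : i = Sum.inr (j+1) <;> simp [hi]
    simp only [Derivation.leibniz, map_add, hp, smul_eq_mul, h, h2]; ring

theorem eq_C_of_pderiv (w : DiffPoly) (h : ∀ i, pderiv i w = 0) : w = C (constantCoeff w) := by
  ext m
  rw [coeff_C]
  split_ifs with hm
  · subst hm; rfl
  · obtain ⟨i, hi⟩ : ∃ i, m i ≠ 0 := by
      by_contra hc; push Not at hc; exact hm (by ext i; simp [hc])
    have := congrArg (coeff (m - Finsupp.single i 1)) (h i)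
    rw [coeff_pderiv] at this
    have hle : Finsupp.single i 1 ≤ m := by simpa using Nat.one_le_iff_ne_zero.mpr hi
    rw [tsub_add_cancel_of_le hle] at this
    simp only [coeff_zero, mul_eq_zero] at this
    rcases this with h | h
    · exact h
    · exact absurd h (by norm_cast)

/-- The kernel of `∂ₓ` consists of the constants. -/
theorem dx_ker (w : DiffPoly) (h : dx w = 0) : w = C (constantCoeff w) := by
  apply eq_C_of_pderiv
  have hb : ∃ N : ℕ, ∀ j ≥ N, pderiv (Sum.inl j) w = 0 ∧ pderiv (Sum.inr j) w = 0 := by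
    refine ⟨w.vars.sup (Sum.elim id id) + 1, fun j hj => ⟨?_, ?_⟩⟩
    · refine pderiv_eq_zero_of_notMem_vars fun hm => ?_
      have := Finset.le_sup (f := Sum.elim id id) hm; simp at this; omega
    · refine pderiv_eq_zero_of_notMem_vars fun hm => ?_
      have := Finset.le_sup (f := Sum.elim id id) hm; simp at this; omega
  obtain ⟨N, hN⟩ := hb
  have key : ∀ d j, j + d ≥ N → pderiv (Sum.inl j) w = 0 ∧ pderiv (Sum.inr j) w = 0 := by
    intro d
    induction d with
    | zero => intro j hj; exact hN j (by omega)
    | succ d ih =>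
      intro j hj
      obtain ⟨h1, h2⟩ := ih (j+1) (by omega)
      have e1 := pderiv_dx_inl j w
      have e2 := pderiv_dx_inr j w
      simp only [h, h1, h2, map_zero, zero_add] at e1 e2
      exact ⟨e1.symm, e2.symm⟩
  rintro (j | j)
  · exact (key N j (by omega)).1
  · exact (key N j (by omega)).2

/-- Primitives with zero constant term are unique. -/
theorem eq_of_dx_eq (v w : DiffPoly) (hv : constantCoeff v = 0) (hw : constantCoeff w = 0)
    (h : dx v = dx w) : v = w := by
  have := dx_ker (v - w) (by simp [h])
  simpa [hv, hw, sub_eq_zero] using this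

theorem dxInv_eq (w p : DiffPoly) (h0 : constantCoeff w = 0) (h : dx w = p) : dxInv p = w := by
  have hex : ∃ w : DiffPoly, constantCoeff w = 0 ∧ dx w = p := ⟨w, h0, h⟩
  rw [dxInv, dif_pos hex]
  exact eq_of_dx_eq _ _ hex.choose_spec.1 h0 (hex.choose_spec.2.trans h.symm)

end

/-- The AKNS recursion operator
`L = [[-∂ₓ + 2q ∂ₓ⁻¹ r, 2q ∂ₓ⁻¹ q], [-2r ∂ₓ⁻¹ r, ∂ₓ - 2r ∂ₓ⁻¹ q]]` acting on pairs. -/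
def recursionOp (P : DiffPoly × DiffPoly) : DiffPoly × DiffPoly :=
  (-dx P.1 + 2 * qVar * dxInv (rVar * P.1 + qVar * P.2),
    dx P.2 - 2 * rVar * dxInv (rVar * P.1 + qVar * P.2))

/-- The AKNS flows `K_m = L^m (-q, r)`; the `m`-th AKNS system is `(q, r)_{t_m} = K_m`. -/
def aknsFlow (m : ℕ) : DiffPoly × DiffPoly := recursionOp^[m] (-qVar, rVar)

/-- The value at `x` of a differential polynomial in the functions `q` and `r`. -/
def evalAt (p : DiffPoly) (q r : ℝ → ℂ) (x : ℝ) : ℂ :=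
  MvPolynomial.eval (Sum.elim (fun j => iteratedDeriv j q x) (fun j => iteratedDeriv j r x)) p

/-! ### The nonlocal NLS hierarchies -/

/-- The reduced potential `r(x) = ε q*(-x)`. -/
def reflected (ε : ℂ) (q : ℝ → ℂ) (x : ℝ) : ℂ := ε * star (q (-x))

/-- The right-hand side `K_k^±` of `i q_{τ_{2k}} = K_k^±[q(x), q(-x)]`, with `ε = ±1`. It is what
the first component `q_{t_{2k}} = K_{2k,1}` of the AKNS system of order `2k` becomes under
`r(x) = ε q*(-x)`, `t_{2k} = i τ_{2k}`, since then `i q_{τ_{2k}} = -q_{t_{2k}}`. -/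
def nlsFlow (ε : ℂ) (k : ℕ) (q : ℝ → ℂ) (x : ℝ) : ℂ :=
  -evalAt (aknsFlow (2 * k)).1 q (reflected ε q) x

/-- `q`, a function of the times `τ = (τ_2, τ_4, …)` (where `τ j` is `τ_{2j}`, `j ≥ 1`) and of `x`,
satisfies `i q_{τ_{2k}} = K_k^±[q(x), q(-x)]` at the point `(τ, x)`, being smooth in `(x, τ_{2k})`
near the two points `±x` that enter the equation. -/
def SolvesAt (ε : ℂ) (k : ℕ) (q : (ℕ → ℝ) → ℝ → ℂ) (τ : ℕ → ℝ) (x : ℝ) : Prop :=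
  ContDiffAt ℝ ∞ (fun p : ℝ × ℝ => q (Function.update τ k p.2) p.1) (x, τ k) ∧
  ContDiffAt ℝ ∞ (fun p : ℝ × ℝ => q (Function.update τ k p.2) p.1) (-x, τ k) ∧
  Complex.I * deriv (fun s : ℝ => q (Function.update τ k s) x) (τ k) = nlsFlow ε k (q τ) x

/-! ### Double Wronskians -/

/-- The determinant of the `N × N` matrix
`(φ, ∂ₓφ, …, ∂ₓ^(p-1) φ; ψ, ∂ₓψ, …, ∂ₓ^(N-p-1) ψ)`. -/
def doubleWronskian {N : ℕ} (p : ℕ) (φ ψ : ℝ → Fin N → ℂ) (x : ℝ) : ℂ :=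
  Matrix.det (Matrix.of fun i j : Fin N =>
    if (j : ℕ) < p then iteratedDeriv (j : ℕ) (fun y => φ y i) x
    else iteratedDeriv ((j : ℕ) - p) (fun y => ψ y i) x)

/-- The matrix `A x + ∑_{j ≥ 1} A^(2j) t_{2j}`, where `t j` is `t_{2j}`. -/
def exponent {N : ℕ} (A : Matrix (Fin N) (Fin N) ℂ) (t : ℕ → ℂ) (x : ℝ) :
    Matrix (Fin N) (Fin N) ℂ :=
  (x : ℂ) • A + ∑' j : ℕ, t (j + 1) • A ^ (2 * (j + 1))

/-- `φ = exp(A x + ∑ A^(2j) t_{2j}) C`. -/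
def phi {N : ℕ} (A : Matrix (Fin N) (Fin N) ℂ) (C : Fin N → ℂ) (t : ℕ → ℂ) (x : ℝ) : Fin N → ℂ :=
  Matrix.mulVec (NormedSpace.exp (exponent A t x)) C

/-- `ψ = exp(-A x - ∑ A^(2j) t_{2j}) D`. -/
def psi {N : ℕ} (A : Matrix (Fin N) (Fin N) ℂ) (D : Fin N → ℂ) (t : ℕ → ℂ) (x : ℝ) : Fin N → ℂ :=
  Matrix.mulVec (NormedSpace.exp (-exponent A t x)) D

/-- The times `t_{2j} = -2^(2j-1) i τ_{2j}`. -/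
def times (τ : ℕ → ℝ) (j : ℕ) : ℂ := -((2 : ℂ) ^ (2 * j) / 2) * Complex.I * (τ j : ℂ)

/-- The double Wronskian with `p` columns from `φ` and the remaining ones from `ψ`, at real times
`τ`. -/
def W {N : ℕ} (A : Matrix (Fin N) (Fin N) ℂ) (C D : Fin N → ℂ) (p : ℕ) (τ : ℕ → ℝ) (x : ℝ) : ℂ :=
  doubleWronskian p (phi A C (times τ)) (psi A D (times τ)) x

/-- `q = 2 |φ^(n+1); ψ^(n-1)| / |φ^(n); ψ^(n)|`. -/
def qSol {n : ℕ} (A : Matrix (Fin (2 * n + 2)) (Fin (2 * n + 2)) ℂ) (C D : Fin (2 * n + 2) → ℂ)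
    (τ : ℕ → ℝ) (x : ℝ) : ℂ :=
  2 * W A C D (n + 2) τ x / W A C D (n + 1) τ x

/-- `r = -2 |φ^(n-1); ψ^(n+1)| / |φ^(n); ψ^(n)|`. -/
def rSol {n : ℕ} (A : Matrix (Fin (2 * n + 2)) (Fin (2 * n + 2)) ℂ) (C D : Fin (2 * n + 2) → ℂ)
    (τ : ℕ → ℝ) (x : ℝ) : ℂ :=
  -2 * W A C D n τ x / W A C D (n + 1) τ x

end NonlocalNLS

end

/-!
The vectors `φ^(j)` and `ψ^(j)` determine, by a linear system with matrix `|φ^(n); ψ^(n)|`, a monic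
polynomial `H` in `λ⁻¹` of degree `n + 1` with `2 × 2` coefficients such that `λ^(n+1) H`, with `λ`
acting as `A`, annihilates `(φ, ψ)`. Wherever the system is invertible, `H` is unique; applied to
the derivatives of `H`, uniqueness yields the Sato equations, and these are the Lax equations for
`S = H⁻¹ σ₃ H` with `σ₃ = diag(1, -1)`. Since `S² = 1`, the equation in `x` forces the coefficients
of `S` to be the AKNS differential polynomials in the off-diagonal entries of its `λ⁻¹` coefficient,
which are `q` and `r` by Cramer's rule; the equations in the times are then the AKNS flows. Finally
`T` conjugates the data at `-x` into the data at `x` with `φ` and `ψ` exchanged, so by uniqueness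
again it relates `H(x)` and `H(-x)`, which is the reduction `r(x) = -δ q*(-x)`.
-/

noncomputable section

namespace NonlocalNLS

open PowerSeries Matrix Filter Topology
open Finset.HasAntidiagonal (antidiagonal mem_antidiagonal)

section FormalLaxEquation

theorem coeff_succ_mul {R : Type*} [CommSemiring R] (f g : R⟦X⟧) (j : ℕ) :
    coeff (j + 1) (f * g) = coeff 0 f * coeff (j + 1) g + coeff (j + 1) f * coeff 0 g +
      ∑ i : Fin j, coeff (i + 1) f * coeff (j - i) g := by
  rw [coeff_mul, Finset.Nat.sum_antidiagonal_eq_sum_range_succ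
    (f := fun a b => coeff a f * coeff b g), Finset.sum_range_succ', Finset.sum_range_succ,
    Fin.sum_univ_eq_sum_range (fun i => coeff (i + 1) f * coeff (j - i) g) j]
  simp only [Nat.add_sub_add_right, Nat.sub_self, Nat.sub_zero]
  ring

theorem two_mul_coeff_succ_of_mul_self_add_mul_eq_one {R : Type*} [CommRing R] {a b c : R⟦X⟧}
    (ha : coeff 0 a = 1) (hb : coeff 0 b = 0) (hc : coeff 0 c = 0) (h : a * a + b * c = 1)
    (j : ℕ) :
    2 * coeff (j + 1) a = -(∑ i : Fin j, coeff (i + 1) a * coeff (j - i) a +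
      ∑ i : Fin j, coeff (i + 1) b * coeff (j - i) c) := by
  have hj := congrArg (coeff (j + 1)) h
  rw [map_add, coeff_succ_mul, coeff_succ_mul, ha, hb, hc, coeff_one,
    if_neg (Nat.succ_ne_zero j)] at hj
  linear_combination hj

/-- The extension of a derivation of `R` to power series over `R`, coefficient by coefficient. -/
def coeffDerivation {k R : Type*} [CommRing k] [CommRing R] [Algebra k R]
    (D : Derivation k R R) : Derivation k R⟦X⟧ R⟦X⟧ :=
  Derivation.mk'
    { toFun := fun f => PowerSeries.mk fun j => D (coeff j f)
      map_add' := fun f g => by ext; simp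
      map_smul' := fun c f => by ext; simp }
    fun f g => by
      ext j
      simp only [LinearMap.coe_mk, AddHom.coe_mk, coeff_mk, map_add, coeff_mul, map_sum,
        Derivation.leibniz, smul_eq_mul, Finset.sum_add_distrib]
      rw [← Finset.Nat.sum_antidiagonal_swap (f := fun p => coeff p.1 g * D (coeff p.2 f))]
      rfl

theorem coeff_coeffDerivation {k R : Type*} [CommRing k] [CommRing R] [Algebra k R]
    (D : Derivation k R R) (f : R⟦X⟧) (j : ℕ) :
    coeff j (coeffDerivation D f) = D (coeff j f) :=
  coeff_mk j fun i => D (coeff i f)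

/-- The coefficients `(a_j, b_j, c_j)` of the formal solution `S = [[a, b], [c, -a]]` of
`S² = 1`, `S_x = [λσ + U, S]`, `σ = diag(1, -1)`, `U = [[0, q], [r, 0]]`, in powers of `λ⁻¹`.
The entry `a` is recovered from `S² = 1` rather than by integrating `a_x = q c - r b`, so that all
the coefficients are visibly differential polynomials. -/
def laxCoeff : ℕ → DiffPoly × DiffPoly × DiffPoly
  | 0 => (1, 0, 0)
  | j + 1 =>
    (-(MvPolynomial.C (1 / 2) * (∑ i : Fin j, (laxCoeff (i + 1)).1 * (laxCoeff (j - i)).1 +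
        ∑ i : Fin j, (laxCoeff (i + 1)).2.1 * (laxCoeff (j - i)).2.2)),
      MvPolynomial.C (1 / 2) * dx (laxCoeff j).2.1 + qVar * (laxCoeff j).1,
      -(MvPolynomial.C (1 / 2) * dx (laxCoeff j).2.2) + rVar * (laxCoeff j).1)
  decreasing_by all_goals omega

theorem laxCoeff_zero : laxCoeff 0 = (1, 0, 0) := by
  rw [laxCoeff]

theorem two_mul_C_half : (2 : DiffPoly) * MvPolynomial.C (1 / 2) = 1 := by
  rw [← map_ofNat (MvPolynomial.C : ℂ →+* DiffPoly) 2, ← map_mul]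
  norm_num

theorem two_mul_laxCoeff_a_succ (j : ℕ) :
    2 * (laxCoeff (j + 1)).1 = -(∑ i : Fin j, (laxCoeff (i + 1)).1 * (laxCoeff (j - i)).1 +
      ∑ i : Fin j, (laxCoeff (i + 1)).2.1 * (laxCoeff (j - i)).2.2) := by
  rw [laxCoeff]
  linear_combination -(∑ i : Fin j, (laxCoeff (i + 1)).1 * (laxCoeff (j - i)).1 +
    ∑ i : Fin j, (laxCoeff (i + 1)).2.1 * (laxCoeff (j - i)).2.2) * two_mul_C_half

theorem two_mul_laxCoeff_b_succ (j : ℕ) :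
    2 * (laxCoeff (j + 1)).2.1 = dx (laxCoeff j).2.1 + 2 * qVar * (laxCoeff j).1 := by
  rw [laxCoeff]
  linear_combination dx (laxCoeff j).2.1 * two_mul_C_half

theorem two_mul_laxCoeff_c_succ (j : ℕ) :
    2 * (laxCoeff (j + 1)).2.2 = -dx (laxCoeff j).2.2 + 2 * rVar * (laxCoeff j).1 := by
  rw [laxCoeff]
  linear_combination -dx (laxCoeff j).2.2 * two_mul_C_half

/-- The generating series of the `a_j`. -/
def laxA : DiffPoly⟦X⟧ := PowerSeries.mk fun j => (laxCoeff j).1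

/-- The generating series of the `b_j`. -/
def laxB : DiffPoly⟦X⟧ := PowerSeries.mk fun j => (laxCoeff j).2.1

/-- The generating series of the `c_j`. -/
def laxC : DiffPoly⟦X⟧ := PowerSeries.mk fun j => (laxCoeff j).2.2

theorem laxA_mul_self_add : laxA * laxA + laxB * laxC = 1 := by
  ext1 j
  cases j with
  | zero => simp [laxA, laxB, laxC, laxCoeff]
  | succ j =>
    rw [map_add, coeff_succ_mul, coeff_succ_mul]
    simp only [laxA, laxB, laxC, coeff_mk, coeff_one, Nat.succ_ne_zero, if_false, laxCoeff_zero]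
    linear_combination two_mul_laxCoeff_a_succ j

theorem X_mul_coeffDerivation_laxB :
    X * coeffDerivation dx laxB = 2 * laxB - 2 * X * C qVar * laxA := by
  ext1 j
  rw [map_sub, mul_assoc 2, mul_assoc 2, two_mul, two_mul, map_add, map_add, mul_assoc X]
  cases j with
  | zero => simp [laxB, laxCoeff]
  | succ j =>
    simp only [coeff_succ_X_mul, coeff_C_mul, coeff_coeffDerivation, laxA, laxB, coeff_mk]
    linear_combination -two_mul_laxCoeff_b_succ j

theorem X_mul_coeffDerivation_laxC :
    X * coeffDerivation dx laxC = -(2 * laxC) + 2 * X * C rVar * laxA := by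
  ext1 j
  rw [map_add, mul_assoc 2, mul_assoc 2, two_mul, two_mul, map_neg, map_add, map_add, mul_assoc X]
  cases j with
  | zero => simp [laxC, laxCoeff]
  | succ j =>
    simp only [coeff_succ_X_mul, coeff_C_mul, coeff_coeffDerivation, laxA, laxC, coeff_mk]
    linear_combination two_mul_laxCoeff_c_succ j

-- Differentiating `a² + b c = 1` and inserting `b_x`, `c_x` gives `2 a (a_x - (q c - r b)) = 0`,
-- and power series over `DiffPoly` form a domain.
theorem coeffDerivation_laxA : coeffDerivation dx laxA = C qVar * laxC - C rVar * laxB := by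
  have hsq := congrArg (coeffDerivation dx) laxA_mul_self_add
  simp only [map_add, Derivation.leibniz, Derivation.map_one_eq_zero, smul_eq_mul] at hsq
  have hzero : X * (2 * (laxA * (coeffDerivation dx laxA - (C qVar * laxC - C rVar * laxB)))) =
      0 := by
    linear_combination X * hsq - laxC * X_mul_coeffDerivation_laxB -
      laxB * X_mul_coeffDerivation_laxC
  have h2 : (2 : DiffPoly⟦X⟧) ≠ 0 := fun h => by
    simpa only [map_ofNat, map_zero, OfNat.ofNat_ne_zero] using
      congrArg (constantCoeff (R := DiffPoly)) h
  have hA : laxA ≠ 0 := fun h => by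
    simpa [laxA, laxCoeff_zero] using congrArg (constantCoeff (R := DiffPoly)) h
  simpa [X_ne_zero, h2, hA, sub_eq_zero] using hzero

theorem dx_laxCoeff_a (j : ℕ) :
    dx (laxCoeff j).1 = qVar * (laxCoeff j).2.2 - rVar * (laxCoeff j).2.1 := by
  simpa [coeff_coeffDerivation, laxA, laxB, laxC] using congrArg (coeff j) coeffDerivation_laxA

theorem constantCoeff_dx (p : DiffPoly) : MvPolynomial.constantCoeff (dx p) = 0 := by
  induction p using MvPolynomial.induction_on with
  | C a => simp [dx]
  | add p q hp hq => simp [hp, hq]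
  | mul_X p i hp => rcases i with i | i <;> simp [dx] at hp ⊢

theorem constantCoeff_laxCoeff_b (j : ℕ) :
    MvPolynomial.constantCoeff (laxCoeff j).2.1 = 0 := by
  cases j with
  | zero => simp [laxCoeff]
  | succ j => rw [laxCoeff]; simp [constantCoeff_dx, qVar]

theorem constantCoeff_laxCoeff_a_succ (j : ℕ) :
    MvPolynomial.constantCoeff (laxCoeff (j + 1)).1 = 0 := by
  induction j using Nat.strong_induction_on with
  | _ j ih =>
    have ha : ∀ i : Fin j, MvPolynomial.constantCoeff (laxCoeff (i + 1)).1 = 0 :=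
      fun i => ih i i.2
    rw [laxCoeff]
    simp [constantCoeff_laxCoeff_b, ha]

theorem recursionOp_laxCoeff (z : ℂ) (j : ℕ) :
    recursionOp (-(z • (laxCoeff (j + 1)).2.1), z • (laxCoeff (j + 1)).2.2) =
      (-((-2 * z) • (laxCoeff (j + 2)).2.1), (-2 * z) • (laxCoeff (j + 2)).2.2) := by
  have hinv : dxInv (rVar * -(z • (laxCoeff (j + 1)).2.1) + qVar * z • (laxCoeff (j + 1)).2.2) =
      z • (laxCoeff (j + 1)).1 := by
    refine dxInv_eq _ _ ?_ ?_
    · rw [MvPolynomial.smul_eq_C_mul, map_mul, constantCoeff_laxCoeff_a_succ, mul_zero]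
    · rw [Derivation.map_smul, dx_laxCoeff_a]
      simp only [MvPolynomial.smul_eq_C_mul]
      ring
  simp only [recursionOp, hinv, map_neg, Derivation.map_smul]
  simp only [MvPolynomial.smul_eq_C_mul, map_mul, map_neg, map_ofNat]
  ext1
  · linear_combination -MvPolynomial.C z * two_mul_laxCoeff_b_succ (j + 1)
  · linear_combination MvPolynomial.C z * two_mul_laxCoeff_c_succ (j + 1)

theorem aknsFlow_eq (m : ℕ) :
    aknsFlow m =
      (-((-2 : ℂ) ^ m • (laxCoeff (m + 1)).2.1), (-2 : ℂ) ^ m • (laxCoeff (m + 1)).2.2) := by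
  induction m with
  | zero =>
    have hb : (laxCoeff 1).2.1 = qVar := by rw [laxCoeff, laxCoeff_zero]; simp
    have hc : (laxCoeff 1).2.2 = rVar := by rw [laxCoeff, laxCoeff_zero]; simp
    simp [aknsFlow, hb, hc]
  | succ m ih =>
    rw [aknsFlow, Function.iterate_succ_apply', ← aknsFlow, ih, recursionOp_laxCoeff, pow_succ']

end FormalLaxEquation

section LaxSolutions

theorem contDiffAt_iteratedDeriv {f : ℝ → ℂ} {x : ℝ} (h : ContDiffAt ℝ ∞ f x) (j : ℕ) :
    ContDiffAt ℝ ∞ (iteratedDeriv j f) x := by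
  induction j with
  | zero => simpa using h
  | succ j ih =>
    rw [iteratedDeriv_succ]
    exact (ih.fderiv_right (m := ∞) (by simp)).clm_apply contDiffAt_const

theorem hasDerivAt_iteratedDeriv {f : ℝ → ℂ} {x : ℝ} (h : ContDiffAt ℝ ∞ f x) (j : ℕ) :
    HasDerivAt (iteratedDeriv j f) (iteratedDeriv (j + 1) f x) x := by
  rw [iteratedDeriv_succ]
  exact ((contDiffAt_iteratedDeriv h j).differentiableAt (by simp)).hasDerivAt

theorem hasDerivAt_evalAt (p : DiffPoly) {q r : ℝ → ℂ} {x : ℝ}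
    (hq : ContDiffAt ℝ ∞ q x) (hr : ContDiffAt ℝ ∞ r x) :
    HasDerivAt (evalAt p q r) (evalAt (dx p) q r x) x := by
  unfold evalAt
  induction p using MvPolynomial.induction_on with
  | C a => simpa [dx] using hasDerivAt_const x a
  | add p p' h h' => simpa only [map_add] using h.fun_add h'
  | mul_X p i h =>
    simp only [map_mul, MvPolynomial.eval_X, Derivation.leibniz, smul_eq_mul, map_add]
    rcases i with j | j
    · exact (h.fun_mul (hasDerivAt_iteratedDeriv hq j)).congr_deriv (by simp [dx]; ring)
    · exact (h.fun_mul (hasDerivAt_iteratedDeriv hr j)).congr_deriv (by simp [dx]; ring)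

/-- `S = [[a, b], [c, -a]]`, a function on `U` with values in power series in `λ⁻¹`, is a
normalized solution of `S² = 1`, `S_x = [λσ + [[0, q], [r, 0]], S]`. -/
structure IsLaxSolution (U : Set ℝ) (q r : ℝ → ℂ) (a b c : ℝ → ℂ⟦X⟧) : Prop where
  coeff_zero_a : ∀ y ∈ U, coeff 0 (a y) = 1
  coeff_zero_b : ∀ y ∈ U, coeff 0 (b y) = 0
  coeff_zero_c : ∀ y ∈ U, coeff 0 (c y) = 0
  mul_self_add : ∀ y ∈ U, a y * a y + b y * c y = 1
  hasDerivAt_b : ∀ y ∈ U, ∀ j, HasDerivAt (fun z => coeff j (b z))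
    (2 * coeff (j + 1) (b y) - 2 * q y * coeff j (a y)) y
  hasDerivAt_c : ∀ y ∈ U, ∀ j, HasDerivAt (fun z => coeff j (c z))
    (-2 * coeff (j + 1) (c y) + 2 * r y * coeff j (a y)) y

namespace IsLaxSolution

variable {U : Set ℝ} {q r : ℝ → ℂ} {a b c : ℝ → ℂ⟦X⟧}

theorem coeff_succ_a_eq_evalAt (h : IsLaxSolution U q r a b c) {y : ℝ} (hy : y ∈ U) {j : ℕ}
    (ha : ∀ i ≤ j, coeff i (a y) = evalAt (laxCoeff i).1 q r y)
    (hb : ∀ i ≤ j, coeff i (b y) = evalAt (laxCoeff i).2.1 q r y)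
    (hc : ∀ i ≤ j, coeff i (c y) = evalAt (laxCoeff i).2.2 q r y) :
    coeff (j + 1) (a y) = evalAt (laxCoeff (j + 1)).1 q r y := by
  have hS := two_mul_coeff_succ_of_mul_self_add_mul_eq_one (h.coeff_zero_a y hy)
    (h.coeff_zero_b y hy) (h.coeff_zero_c y hy) (h.mul_self_add y hy) j
  have hL := congrArg (fun p => evalAt p q r y) (two_mul_laxCoeff_a_succ j)
  have haa : ∀ i : Fin j, coeff (i + 1) (a y) * coeff (j - i) (a y) =
      evalAt (laxCoeff (i + 1)).1 q r y * evalAt (laxCoeff (j - i)).1 q r y := fun i => by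
    rw [ha _ (by omega), ha _ (by omega)]
  have hbc : ∀ i : Fin j, coeff (i + 1) (b y) * coeff (j - i) (c y) =
      evalAt (laxCoeff (i + 1)).2.1 q r y * evalAt (laxCoeff (j - i)).2.2 q r y := fun i => by
    rw [hb _ (by omega), hc _ (by omega)]
  simp only [haa, hbc] at hS
  simp only [evalAt, map_mul, map_neg, map_add, map_sum, map_ofNat] at hS hL ⊢
  linear_combination (hS - hL) / 2

theorem coeff_succ_b_eq_evalAt (h : IsLaxSolution U q r a b c) (hU : IsOpen U) {y : ℝ}
    (hy : y ∈ U) (hq : ContDiffAt ℝ ∞ q y) (hr : ContDiffAt ℝ ∞ r y) {j : ℕ}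
    (ha : coeff j (a y) = evalAt (laxCoeff j).1 q r y)
    (hb : ∀ z ∈ U, coeff j (b z) = evalAt (laxCoeff j).2.1 q r z) :
    coeff (j + 1) (b y) = evalAt (laxCoeff (j + 1)).2.1 q r y := by
  have hS := (h.hasDerivAt_b y hy j).unique ((hasDerivAt_evalAt (laxCoeff j).2.1 hq
    hr).congr_of_eventuallyEq (eventually_of_mem (hU.mem_nhds hy) hb))
  have hL := congrArg (fun p => evalAt p q r y) (two_mul_laxCoeff_b_succ j)
  rw [ha] at hS
  simp only [evalAt, map_add, map_mul, map_ofNat, qVar, MvPolynomial.eval_X, Sum.elim_inl,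
    iteratedDeriv_zero] at hS hL ⊢
  linear_combination (hS - hL) / 2

theorem coeff_succ_c_eq_evalAt (h : IsLaxSolution U q r a b c) (hU : IsOpen U) {y : ℝ}
    (hy : y ∈ U) (hq : ContDiffAt ℝ ∞ q y) (hr : ContDiffAt ℝ ∞ r y) {j : ℕ}
    (ha : coeff j (a y) = evalAt (laxCoeff j).1 q r y)
    (hc : ∀ z ∈ U, coeff j (c z) = evalAt (laxCoeff j).2.2 q r z) :
    coeff (j + 1) (c y) = evalAt (laxCoeff (j + 1)).2.2 q r y := by
  have hS := (h.hasDerivAt_c y hy j).unique ((hasDerivAt_evalAt (laxCoeff j).2.2 hq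
    hr).congr_of_eventuallyEq (eventually_of_mem (hU.mem_nhds hy) hc))
  have hL := congrArg (fun p => evalAt p q r y) (two_mul_laxCoeff_c_succ j)
  rw [ha] at hS
  simp only [evalAt, map_add, map_mul, map_neg, map_ofNat, rVar, MvPolynomial.eval_X,
    Sum.elim_inr, iteratedDeriv_zero] at hS hL ⊢
  linear_combination -(hS + hL) / 2

theorem coeff_eq_evalAt_laxCoeff (h : IsLaxSolution U q r a b c) (hU : IsOpen U)
    (hq : ∀ y ∈ U, ContDiffAt ℝ ∞ q y) (hr : ∀ y ∈ U, ContDiffAt ℝ ∞ r y) (j : ℕ) :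
    ∀ y ∈ U, coeff j (a y) = evalAt (laxCoeff j).1 q r y ∧
      coeff j (b y) = evalAt (laxCoeff j).2.1 q r y ∧
      coeff j (c y) = evalAt (laxCoeff j).2.2 q r y := by
  induction j using Nat.strong_induction_on with
  | _ j ih =>
    intro y hy
    cases j with
    | zero =>
      simp [evalAt, laxCoeff_zero, h.coeff_zero_a y hy, h.coeff_zero_b y hy, h.coeff_zero_c y hy]
    | succ j =>
      have hle : ∀ i ≤ j, i < j + 1 := fun i hi => by omega
      refine ⟨h.coeff_succ_a_eq_evalAt hy (fun i hi => (ih i (hle i hi) y hy).1)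
        (fun i hi => (ih i (hle i hi) y hy).2.1) (fun i hi => (ih i (hle i hi) y hy).2.2), ?_, ?_⟩
      · exact h.coeff_succ_b_eq_evalAt hU hy (hq y hy) (hr y hy) (ih j j.lt_succ_self y hy).1
          fun z hz => (ih j j.lt_succ_self z hz).2.1
      · exact h.coeff_succ_c_eq_evalAt hU hy (hq y hy) (hr y hy) (ih j j.lt_succ_self y hy).1
          fun z hz => (ih j j.lt_succ_self z hz).2.2

end IsLaxSolution

end LaxSolutions

section MatrixSeries

variable {K : Type*} [CommRing K] {l m n : Type*}

/-- The matrix of the `d`-th coefficients of a matrix of power series. -/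
def coeffMatrix (d : ℕ) : Matrix m n K⟦X⟧ →ₗ[K] Matrix m n K := (PowerSeries.coeff d).mapMatrix

theorem coeffMatrix_apply (d : ℕ) (P : Matrix m n K⟦X⟧) (i : m) (j : n) :
    coeffMatrix d P i j = coeff d (P i j) := rfl

theorem ext_coeffMatrix {P Q : Matrix m n K⟦X⟧} (h : ∀ d, coeffMatrix d P = coeffMatrix d Q) :
    P = Q := by
  ext i j d
  exact congrFun₂ (h d) i j

theorem coeffMatrix_mul [Fintype m] (d : ℕ) (P : Matrix l m K⟦X⟧) (Q : Matrix m n K⟦X⟧) :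
    coeffMatrix d (P * Q) =
      ∑ e ∈ antidiagonal d, coeffMatrix e.1 P * coeffMatrix e.2 Q := by
  ext i j
  simp only [coeffMatrix_apply, Matrix.mul_apply, map_sum, coeff_mul, Matrix.sum_apply]
  exact Finset.sum_comm

theorem coeffMatrix_zero_mul [Fintype m] (P : Matrix l m K⟦X⟧) (Q : Matrix m n K⟦X⟧) :
    coeffMatrix 0 (P * Q) = coeffMatrix 0 P * coeffMatrix 0 Q := by
  simp [coeffMatrix_mul]

theorem coeffMatrix_one_mul [Fintype m] (P : Matrix l m K⟦X⟧) (Q : Matrix m n K⟦X⟧) :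
    coeffMatrix 1 (P * Q) =
      coeffMatrix 0 P * coeffMatrix 1 Q + coeffMatrix 1 P * coeffMatrix 0 Q := by
  rw [coeffMatrix_mul, Finset.Nat.antidiagonal_succ]
  simp

theorem coeffMatrix_map_C (d : ℕ) (B : Matrix m n K) :
    coeffMatrix d (B.map (C (R := K))) = if d = 0 then B else 0 := by
  ext i j
  rw [coeffMatrix_apply, Matrix.map_apply, coeff_C]
  split_ifs <;> rfl

theorem coeffMatrix_one [DecidableEq m] (d : ℕ) :
    coeffMatrix d (1 : Matrix m m K⟦X⟧) = if d = 0 then 1 else 0 := by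
  rw [← Matrix.map_one (C (R := K)) (map_zero _) (map_one _), coeffMatrix_map_C]

theorem coeffMatrix_map_C_mul [Fintype m] (d : ℕ) (B : Matrix l m K) (P : Matrix m n K⟦X⟧) :
    coeffMatrix d (B.map (C (R := K)) * P) = B * coeffMatrix d P := by
  ext i j
  simp [coeffMatrix_apply, Matrix.mul_apply]

theorem coeffMatrix_mul_map_C [Fintype m] (d : ℕ) (P : Matrix l m K⟦X⟧) (B : Matrix m n K) :
    coeffMatrix d (P * B.map (C (R := K))) = coeffMatrix d P * B := by
  ext i j
  simp [coeffMatrix_apply, Matrix.mul_apply]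

theorem coeffMatrix_add_X_pow_smul (d k : ℕ) (P : Matrix m n K⟦X⟧) :
    coeffMatrix (d + k) ((X : K⟦X⟧) ^ k • P) = coeffMatrix d P := by
  ext i j
  simp [coeffMatrix_apply, coeff_X_pow_mul]

theorem coeffMatrix_X_pow_smul_of_lt {d k : ℕ} (h : d < k) (P : Matrix m n K⟦X⟧) :
    coeffMatrix d ((X : K⟦X⟧) ^ k • P) = 0 := by
  ext i j
  simp [coeffMatrix_apply, coeff_X_pow_mul', h.not_ge]

theorem isUnit_det_of_coeffMatrix_zero [Fintype m] [DecidableEq m] {H : Matrix m m K⟦X⟧}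
    (h : coeffMatrix 0 H = 1) : IsUnit H.det := by
  have hmap : (constantCoeff (R := K)).mapMatrix H = 1 := by
    rw [← h]
    ext i j
    simp [coeffMatrix_apply]
  rw [PowerSeries.isUnit_iff_constantCoeff, RingHom.map_det, hmap, Matrix.det_one]
  exact isUnit_one

/-- The entries of `P` are polynomials of degree at most `d`. -/
def DegreeLE (d : ℕ) (P : Matrix m n K⟦X⟧) : Prop := ∀ e, d < e → coeffMatrix e P = 0

namespace DegreeLE

variable {d e : ℕ}

theorem add {P Q : Matrix m n K⟦X⟧} (hP : DegreeLE d P) (hQ : DegreeLE d Q) :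
    DegreeLE d (P + Q) := fun k hk => by
  rw [map_add, hP k hk, hQ k hk, add_zero]

theorem neg {P : Matrix m n K⟦X⟧} (hP : DegreeLE d P) : DegreeLE d (-P) := fun k hk => by
  rw [map_neg, hP k hk, neg_zero]

theorem sub {P Q : Matrix m n K⟦X⟧} (hP : DegreeLE d P) (hQ : DegreeLE d Q) :
    DegreeLE d (P - Q) :=
  sub_eq_add_neg P Q ▸ hP.add hQ.neg

theorem smul {P : Matrix m n K⟦X⟧} (hP : DegreeLE d P) (κ : K) : DegreeLE d (κ • P) :=
  fun k hk => by rw [map_smul, hP k hk, smul_zero]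

theorem mono {P : Matrix m n K⟦X⟧} (hP : DegreeLE d P) (h : d ≤ e) : DegreeLE e P :=
  fun k hk => hP k (h.trans_lt hk)

theorem mul [Fintype m] {P : Matrix l m K⟦X⟧} {Q : Matrix m n K⟦X⟧} (hP : DegreeLE d P)
    (hQ : DegreeLE e Q) : DegreeLE (d + e) (P * Q) := fun k hk => by
  rw [coeffMatrix_mul]
  refine Finset.sum_eq_zero fun p hp => ?_
  rw [mem_antidiagonal] at hp
  rcases lt_or_ge d p.1 with h | h
  · rw [hP _ h, Matrix.zero_mul]
  · rw [hQ _ (by omega), Matrix.mul_zero]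

theorem map_C_mul [Fintype m] (B : Matrix l m K) {P : Matrix m n K⟦X⟧} (hP : DegreeLE d P) :
    DegreeLE d (B.map (C (R := K)) * P) := fun k hk => by
  rw [coeffMatrix_map_C_mul, hP k hk, Matrix.mul_zero]

theorem mul_map_C [Fintype m] {P : Matrix l m K⟦X⟧} (hP : DegreeLE d P) (B : Matrix m n K) :
    DegreeLE d (P * B.map (C (R := K))) := fun k hk => by
  rw [coeffMatrix_mul_map_C, hP k hk, Matrix.zero_mul]

theorem of_X_pow_smul {k : ℕ} {P : Matrix m n K⟦X⟧}
    (h : DegreeLE (d + k) ((X : K⟦X⟧) ^ k • P)) : DegreeLE d P := fun e he => by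
  rw [← coeffMatrix_add_X_pow_smul e k]
  exact h _ (by omega)

end DegreeLE

/-- The terms of degree at most `k` of a matrix of power series. -/
def lowPart (k : ℕ) (S : Matrix m n K⟦X⟧) : Matrix m n K⟦X⟧ :=
  .of fun i j => .mk fun d => if d ≤ k then coeff d (S i j) else 0

/-- The terms of degree greater than `k` of a matrix of power series, divided by `X ^ k`. -/
def highPart (k : ℕ) (S : Matrix m n K⟦X⟧) : Matrix m n K⟦X⟧ :=
  .of fun i j => .mk fun d => if d = 0 then 0 else coeff (d + k) (S i j)

theorem coeffMatrix_lowPart (d k : ℕ) (S : Matrix m n K⟦X⟧) :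
    coeffMatrix d (lowPart k S) = if d ≤ k then coeffMatrix d S else 0 := by
  ext i j
  rw [coeffMatrix_apply, lowPart, Matrix.of_apply, coeff_mk]
  split_ifs <;> rfl

theorem coeffMatrix_highPart (d k : ℕ) (S : Matrix m n K⟦X⟧) :
    coeffMatrix d (highPart k S) = if d = 0 then 0 else coeffMatrix (d + k) S := by
  ext i j
  rw [coeffMatrix_apply, highPart, Matrix.of_apply, coeff_mk]
  split_ifs <;> rfl

theorem lowPart_add_X_pow_smul_highPart (k : ℕ) (S : Matrix m n K⟦X⟧) :
    lowPart k S + (X : K⟦X⟧) ^ k • highPart k S = S := by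
  refine ext_coeffMatrix fun d => ?_
  rw [map_add, coeffMatrix_lowPart]
  rcases lt_or_ge d k with h | h
  · rw [if_pos h.le, coeffMatrix_X_pow_smul_of_lt h, add_zero]
  · obtain ⟨e, rfl⟩ := Nat.exists_eq_add_of_le' h
    rw [coeffMatrix_add_X_pow_smul, coeffMatrix_highPart]
    rcases e.eq_zero_or_pos with rfl | he
    · simp
    · rw [if_neg (by omega), if_neg he.ne', zero_add]

theorem X_pow_smul_mul_highPart [Fintype m] {H : Matrix l m K⟦X⟧} {S : Matrix m n K⟦X⟧}
    {G : Matrix l n K⟦X⟧} (k : ℕ) (hS : H * S = G) :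
    (X : K⟦X⟧) ^ k • (H * highPart k S) = G - H * lowPart k S := by
  rw [← hS, ← Matrix.mul_smul, ← Matrix.mul_sub]
  congr 1
  rw [eq_sub_iff_add_eq', lowPart_add_X_pow_smul_highPart]

theorem degreeLE_lowPart (k : ℕ) (S : Matrix m n K⟦X⟧) : DegreeLE k (lowPart k S) :=
  fun d hd => by rw [coeffMatrix_lowPart, if_neg hd.not_ge]

theorem lowPart_one (S : Matrix m n K⟦X⟧) :
    lowPart 1 S = (coeffMatrix 0 S).map (C (R := K)) +
      (X : K⟦X⟧) ^ 1 • (coeffMatrix 1 S).map (C (R := K)) := by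
  refine ext_coeffMatrix fun d => ?_
  rw [coeffMatrix_lowPart, map_add, coeffMatrix_map_C]
  rcases d with _ | d
  · rw [coeffMatrix_X_pow_smul_of_lt one_pos]
    simp
  · rw [coeffMatrix_add_X_pow_smul, coeffMatrix_map_C]
    rcases d with _ | d <;> simp

theorem coeffMatrix_succ_mul_lowPart_one_sub [Fintype m] (S : Matrix m m K⟦X⟧) (j : ℕ) :
    coeffMatrix (j + 1) (S * lowPart 1 S - lowPart 1 S * S) =
      coeffMatrix (j + 1) S * coeffMatrix 0 S - coeffMatrix 0 S * coeffMatrix (j + 1) S +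
        (coeffMatrix j S * coeffMatrix 1 S - coeffMatrix 1 S * coeffMatrix j S) := by
  simp only [lowPart_one, Matrix.mul_add, Matrix.add_mul, Matrix.mul_smul, Matrix.smul_mul,
    map_sub, map_add, coeffMatrix_add_X_pow_smul, coeffMatrix_mul_map_C, coeffMatrix_map_C_mul]
  abel

end MatrixSeries

section CoefficientwiseDerivatives

variable {𝕜 𝔸 : Type*} [NontriviallyNormedField 𝕜] [NormedCommRing 𝔸] [NormedAlgebra 𝕜 𝔸]
  {l m n : Type*} {y : 𝕜}

/-- Every coefficient of every entry of the matrix of power series `M` is differentiable at `y`,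
with derivative the corresponding coefficient of `M'`. -/
def HasCoeffDerivAt (M : 𝕜 → Matrix m n 𝔸⟦X⟧) (M' : Matrix m n 𝔸⟦X⟧) (y : 𝕜) : Prop :=
  ∀ d i j, HasDerivAt (fun z => coeffMatrix d (M z) i j) (coeffMatrix d M' i j) y

namespace HasCoeffDerivAt

theorem unique {M : 𝕜 → Matrix m n 𝔸⟦X⟧} {M' M'' : Matrix m n 𝔸⟦X⟧}
    (h' : HasCoeffDerivAt M M' y) (h'' : HasCoeffDerivAt M M'' y) : M' = M'' :=
  ext_coeffMatrix fun d => by ext i j; exact (h' d i j).unique (h'' d i j)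

theorem coeffMatrix_eq_zero {M : 𝕜 → Matrix m n 𝔸⟦X⟧} {M' : Matrix m n 𝔸⟦X⟧} {d : ℕ}
    {B : Matrix m n 𝔸} (h : HasCoeffDerivAt M M' y) (hB : ∀ᶠ z in 𝓝 y, coeffMatrix d (M z) = B) :
    coeffMatrix d M' = 0 := by
  ext i j
  exact (h d i j).unique ((hasDerivAt_const y (B i j)).congr_of_eventuallyEq
    (hB.mono fun z hz => congrFun₂ hz i j))

theorem mul [Fintype m] {P : 𝕜 → Matrix l m 𝔸⟦X⟧} {Q : 𝕜 → Matrix m n 𝔸⟦X⟧}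
    {P' : Matrix l m 𝔸⟦X⟧} {Q' : Matrix m n 𝔸⟦X⟧} (hP : HasCoeffDerivAt P P' y)
    (hQ : HasCoeffDerivAt Q Q' y) :
    HasCoeffDerivAt (fun z => P z * Q z) (P' * Q y + P y * Q') y := fun d i j => by
  simp only [map_add, coeffMatrix_mul, Matrix.add_apply, Matrix.sum_apply, Matrix.mul_apply,
    ← Finset.sum_add_distrib]
  exact HasDerivAt.fun_sum fun e _ => HasDerivAt.fun_sum fun k _ => (hP e.1 i k).mul (hQ e.2 k j)

theorem const_mul [Fintype m] (B : Matrix l m 𝔸) {Q : 𝕜 → Matrix m n 𝔸⟦X⟧}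
    {Q' : Matrix m n 𝔸⟦X⟧} (hQ : HasCoeffDerivAt Q Q' y) :
    HasCoeffDerivAt (fun z => B.map (C (R := 𝔸)) * Q z) (B.map (C (R := 𝔸)) * Q') y :=
  fun d i j => by
    simp only [coeffMatrix_map_C_mul, Matrix.mul_apply]
    exact HasDerivAt.fun_sum fun k _ => (hQ d k j).const_mul _

theorem exists_of_mul_eq [Fintype m] [DecidableEq m] {H : 𝕜 → Matrix m m 𝔸⟦X⟧}
    {S G : 𝕜 → Matrix m n 𝔸⟦X⟧} {H' : Matrix m m 𝔸⟦X⟧} {G' : Matrix m n 𝔸⟦X⟧}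
    (hH : HasCoeffDerivAt H H' y) (hG : HasCoeffDerivAt G G' y)
    (hH0 : ∀ z, coeffMatrix 0 (H z) = 1) (hmul : ∀ z, H z * S z = G z) :
    ∃ S', HasCoeffDerivAt S S' y := by
  have hS0 : ∀ z, coeffMatrix 0 (S z) = coeffMatrix 0 (G z) := fun z => by
    rw [← hmul z, coeffMatrix_zero_mul, hH0, Matrix.one_mul]
  have hS : ∀ d z, coeffMatrix (d + 1) (S z) = coeffMatrix (d + 1) (G z) -
      ∑ e ∈ antidiagonal d, coeffMatrix (e.1 + 1) (H z) * coeffMatrix e.2 (S z) :=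
    fun d z => by
      rw [← hmul z, coeffMatrix_mul, Finset.Nat.sum_antidiagonal_succ, hH0, Matrix.one_mul,
        add_sub_cancel_right]
  have hdiff : ∀ d i j, DifferentiableAt 𝕜 (fun z => coeffMatrix d (S z) i j) y := by
    intro d
    induction d using Nat.strong_induction_on with
    | _ d ih =>
      intro i j
      rcases d with _ | d
      · simpa only [hS0] using (hG 0 i j).differentiableAt
      · simp only [hS, Matrix.sub_apply, Matrix.sum_apply, Matrix.mul_apply]
        refine (hG (d + 1) i j).differentiableAt.fun_sub (DifferentiableAt.fun_sum fun e he =>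
          DifferentiableAt.fun_sum fun k _ => (hH (e.1 + 1) i k).differentiableAt.fun_mul
            (ih e.2 ?_ k j))
        rw [mem_antidiagonal] at he
        omega
  refine ⟨.of fun i j => .mk fun d => deriv (fun z => coeffMatrix d (S z) i j) y, fun d i j => ?_⟩
  rw [coeffMatrix_apply, Matrix.of_apply, coeff_mk]
  exact (hdiff d i j).hasDerivAt

end HasCoeffDerivAt

end CoefficientwiseDerivatives

section Dressing

variable {K : Type*} [CommRing K] {ν ι κ : Type*} [Fintype ν] [DecidableEq ν]

/-- The generating series `∑ A ^ d * F * X ^ d` of the Krylov vectors of the columns of `F`. -/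
def krylovSeries (A : Matrix ν ν K) (F : Matrix ν ι K) : Matrix ν ι K⟦X⟧ :=
  .of fun i a => .mk fun d => (A ^ d * F) i a

theorem coeffMatrix_krylovSeries (d : ℕ) (A : Matrix ν ν K) (F : Matrix ν ι K) :
    coeffMatrix d (krylovSeries A F) = A ^ d * F := by
  ext i a
  rw [coeffMatrix_apply, krylovSeries, Matrix.of_apply, coeff_mk]

variable [Fintype ι]

theorem krylovSeries_mul_mul {A B : Matrix ν ν K} (h : Commute B A) (F : Matrix ν ι K)
    (σ : Matrix ι κ K) :
    krylovSeries A (B * F * σ) =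
      B.map (C (R := K)) * krylovSeries A F * σ.map (C (R := K)) := by
  refine ext_coeffMatrix fun d => ?_
  rw [coeffMatrix_mul_map_C, coeffMatrix_map_C_mul, coeffMatrix_krylovSeries,
    coeffMatrix_krylovSeries, ← Matrix.mul_assoc, ← Matrix.mul_assoc, ← Matrix.mul_assoc,
    (h.pow_right d).eq]

theorem coeffMatrix_krylovSeries_mul (A : Matrix ν ν K) (F : Matrix ν ι K) (d : ℕ)
    (P : Matrix ι κ K⟦X⟧) :
    coeffMatrix d (krylovSeries A F * P) =
      ∑ e ∈ antidiagonal d, A ^ e.1 * F * coeffMatrix e.2 P := by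
  simp only [coeffMatrix_mul, coeffMatrix_krylovSeries]

theorem coeffMatrix_succ_krylovSeries_mul (A : Matrix ν ν K) (F : Matrix ν ι K) (d : ℕ)
    (P : Matrix ι κ K⟦X⟧) :
    coeffMatrix (d + 1) (krylovSeries A F * P) =
      F * coeffMatrix (d + 1) P + A * coeffMatrix d (krylovSeries A F * P) := by
  rw [coeffMatrix_krylovSeries_mul, coeffMatrix_krylovSeries_mul,
    Finset.Nat.sum_antidiagonal_succ, Matrix.mul_sum, pow_zero, Matrix.one_mul]
  simp only [pow_succ', Matrix.mul_assoc]

theorem DegreeLE.coeffMatrix_add_krylovSeries_mul {p : ℕ} {P : Matrix ι κ K⟦X⟧}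
    (hP : DegreeLE p P) (A : Matrix ν ν K) (F : Matrix ν ι K) (k : ℕ) :
    coeffMatrix (p + k) (krylovSeries A F * P) = A ^ k * coeffMatrix p (krylovSeries A F * P) := by
  induction k with
  | zero => simp
  | succ k ih =>
    rw [← Nat.add_assoc, coeffMatrix_succ_krylovSeries_mul, hP _ (by omega), ih, Matrix.mul_zero,
      zero_add, pow_succ', Matrix.mul_assoc]

/-- `H` is the dressing matrix of order `p` of the Krylov data `(A, F)`: the polynomial matrix
`λ ^ p H(1 / λ)` is monic of degree `p` and annihilates `F` when `λ` acts as `A`. -/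
structure IsDressing [DecidableEq ι] (A : Matrix ν ν K) (F : Matrix ν ι K) (p : ℕ)
    (H : Matrix ι ι K⟦X⟧) : Prop where
  coeff_zero : coeffMatrix 0 H = 1
  degreeLE : DegreeLE p H
  coeff_krylovSeries_mul : coeffMatrix p (krylovSeries A F * H) = 0

/-- No nonzero matrix `Z` of polynomials of degree at most `p` without constant term satisfies the
linear equation of `IsDressing`, so that dressing matrices of order `p` are unique. -/
def IsKrylovRegular (A : Matrix ν ν K) (F : Matrix ν ι K) (p : ℕ) : Prop :=
  ∀ Z : Matrix ι ι K⟦X⟧, coeffMatrix 0 Z = 0 → DegreeLE p Z →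
    coeffMatrix p (krylovSeries A F * Z) = 0 → Z = 0

variable [DecidableEq ι] {A : Matrix ν ν K} {F : Matrix ν ι K} {p : ℕ}

theorem IsDressing.unique {H H' : Matrix ι ι K⟦X⟧} (h : IsDressing A F p H)
    (h' : IsDressing A F p H') (hreg : IsKrylovRegular A F p) : H = H' :=
  sub_eq_zero.mp <| hreg _ (by rw [map_sub, h.coeff_zero, h'.coeff_zero, sub_self])
    (h.degreeLE.sub h'.degreeLE)
    (by rw [Matrix.mul_sub, map_sub, h.coeff_krylovSeries_mul, h'.coeff_krylovSeries_mul,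
      sub_self])

theorem IsDressing.coeff_krylovSeries_mul_of_le {H : Matrix ι ι K⟦X⟧} (h : IsDressing A F p H)
    {d : ℕ} (hd : p ≤ d) : coeffMatrix d (krylovSeries A F * H) = 0 := by
  obtain ⟨k, rfl⟩ := Nat.exists_eq_add_of_le hd
  rw [h.degreeLE.coeffMatrix_add_krylovSeries_mul, h.coeff_krylovSeries_mul, Matrix.mul_zero]

theorem IsDressing.coeff_krylovSeries_mul_mul {H : Matrix ι ι K⟦X⟧} (h : IsDressing A F p H)
    {k : ℕ} {V : Matrix ι ι K⟦X⟧} (hV : DegreeLE k V) :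
    coeffMatrix (p + k) (krylovSeries A F * (H * V)) = 0 := by
  rw [← Matrix.mul_assoc, coeffMatrix_mul]
  refine Finset.sum_eq_zero fun e he => ?_
  rw [mem_antidiagonal] at he
  rcases lt_or_ge k e.2 with hk | hk
  · rw [hV _ hk, Matrix.mul_zero]
  · rw [h.coeff_krylovSeries_mul_of_le (by omega), Matrix.zero_mul]

theorem IsDressing.degreeLE_mul_highPart {H S : Matrix ι ι K⟦X⟧} (h : IsDressing A F p H)
    {σ : Matrix ι ι K} (hS : H * S = σ.map (C (R := K)) * H) (k : ℕ) :
    DegreeLE p (H * highPart k S) := by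
  refine DegreeLE.of_X_pow_smul (k := k) ?_
  rw [X_pow_smul_mul_highPart k hS]
  exact ((h.degreeLE.map_C_mul σ).mono (by omega)).sub (h.degreeLE.mul (degreeLE_lowPart k S))

theorem IsDressing.pow_mul_coeff_krylovSeries_mul {H S : Matrix ι ι K⟦X⟧}
    (h : IsDressing A F p H) {σ : Matrix ι ι K} (hS : H * S = σ.map (C (R := K)) * H) (k : ℕ) :
    A ^ k * coeffMatrix p (krylovSeries A F * (σ.map (C (R := K)) * H)) =
      coeffMatrix p (krylovSeries A F * (H * highPart k S)) := by
  have hsplit : σ.map (C (R := K)) * H =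
      (X : K⟦X⟧) ^ k • (H * highPart k S) + H * lowPart k S := by
    rw [X_pow_smul_mul_highPart k hS, sub_add_cancel]
  rw [← (h.degreeLE.map_C_mul σ).coeffMatrix_add_krylovSeries_mul, hsplit, Matrix.mul_add,
    map_add, h.coeff_krylovSeries_mul_mul (degreeLE_lowPart k S), add_zero, Matrix.mul_smul,
    coeffMatrix_add_X_pow_smul]

end Dressing

section DressingFlow

variable {𝕜 𝔸 : Type*} [NontriviallyNormedField 𝕜] [NormedCommRing 𝔸] [NormedAlgebra 𝕜 𝔸]
  {ν ι : Type*} [Fintype ν] [DecidableEq ν]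

theorem hasCoeffDerivAt_krylovSeries (A : Matrix ν ν 𝔸) {F : 𝕜 → Matrix ν ι 𝔸}
    {F' : Matrix ν ι 𝔸} {y : 𝕜} (hF : ∀ i a, HasDerivAt (fun z => F z i a) (F' i a) y) :
    HasCoeffDerivAt (fun z => krylovSeries A (F z)) (krylovSeries A F') y := fun d i a => by
  simp only [coeffMatrix_krylovSeries, Matrix.mul_apply]
  exact HasDerivAt.fun_sum fun j _ => (hF j a).const_mul _

variable [Fintype ι] [DecidableEq ι] {A : Matrix ν ν 𝔸} {F : 𝕜 → Matrix ν ι 𝔸} {p : ℕ}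
  {H : 𝕜 → Matrix ι ι 𝔸⟦X⟧} {H' : Matrix ι ι 𝔸⟦X⟧} {σ : Matrix ι ι 𝔸} {κ : 𝔸} {k : ℕ} {y : 𝕜}

-- Differentiating `(krylovSeries A F * H)_p = 0` shows that `H' + κ H (highPart k S)` solves the
-- homogeneous linear system, whose only solution is `0`.
theorem sato_equation {S : Matrix ι ι 𝔸⟦X⟧} (hreg : IsKrylovRegular A (F y) p)
    (hdress : ∀ᶠ z in 𝓝 y, IsDressing A (F z) p (H z))
    (hF : ∀ i a, HasDerivAt (fun z => F z i a) (((κ • A ^ k) * F y * σ) i a) y)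
    (hH : HasCoeffDerivAt H H' y) (hS : H y * S = σ.map (C (R := 𝔸)) * H y) :
    H' = -κ • (H y * highPart k S) := by
  have hy := hdress.self_of_nhds
  have hcomm : Commute (κ • A ^ k) A := ((Commute.refl A).pow_left k).smul_left κ
  have hder : coeffMatrix p (krylovSeries A ((κ • A ^ k) * F y * σ) * H y +
      krylovSeries A (F y) * H') = 0 :=
    ((hasCoeffDerivAt_krylovSeries A hF).mul hH).coeffMatrix_eq_zero
      (hdress.mono fun z hz => hz.coeff_krylovSeries_mul)
  rw [map_add, krylovSeries_mul_mul hcomm, Matrix.mul_assoc, Matrix.mul_assoc,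
    coeffMatrix_map_C_mul, Matrix.smul_mul, hy.pow_mul_coeff_krylovSeries_mul hS] at hder
  rw [neg_smul, eq_neg_iff_add_eq_zero]
  refine hreg _ ?_ ?_ ?_
  · rw [map_add, map_smul, coeffMatrix_zero_mul, coeffMatrix_highPart, if_pos rfl,
      hH.coeffMatrix_eq_zero (hdress.mono fun z hz => hz.coeff_zero), Matrix.mul_zero, smul_zero,
      add_zero]
  · refine DegreeLE.add (fun d hd => ?_) ((hy.degreeLE_mul_highPart hS k).smul κ)
    exact hH.coeffMatrix_eq_zero (hdress.mono fun z hz => hz.degreeLE d hd)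
  · rw [Matrix.mul_add, map_add, Matrix.mul_smul, map_smul, add_comm, hder]

theorem coeffMatrix_one_sato_equation {S : Matrix ι ι 𝔸⟦X⟧} (hreg : IsKrylovRegular A (F y) p)
    (hdress : ∀ᶠ z in 𝓝 y, IsDressing A (F z) p (H z))
    (hF : ∀ i a, HasDerivAt (fun z => F z i a) (((κ • A ^ k) * F y * σ) i a) y)
    (hH : HasCoeffDerivAt H H' y) (hS : H y * S = σ.map (C (R := 𝔸)) * H y) :
    coeffMatrix 1 H' = -κ • coeffMatrix (k + 1) S := by
  rw [sato_equation hreg hdress hF hH hS, map_smul, coeffMatrix_one_mul,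
    hdress.self_of_nhds.coeff_zero, coeffMatrix_highPart, coeffMatrix_highPart, if_pos rfl,
    if_neg (by omega), Matrix.one_mul, Matrix.mul_zero, add_zero, Nat.add_comm k]

theorem lax_equation {S : 𝕜 → Matrix ι ι 𝔸⟦X⟧} {S' : Matrix ι ι 𝔸⟦X⟧}
    (hreg : IsKrylovRegular A (F y) p) (hdress : ∀ᶠ z in 𝓝 y, IsDressing A (F z) p (H z))
    (hF : ∀ i a, HasDerivAt (fun z => F z i a) (((κ • A ^ k) * F y * σ) i a) y)
    (hH : HasCoeffDerivAt H H' y) (hS' : HasCoeffDerivAt S S' y)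
    (hS : ∀ z, H z * S z = σ.map (C (R := 𝔸)) * H z) :
    (X : 𝔸⟦X⟧) ^ k • S' = κ • (S y * lowPart k (S y) - lowPart k (S y) * S y) := by
  have hsato : (X : 𝔸⟦X⟧) ^ k • H' =
      κ • (H y * lowPart k (S y) - σ.map (C (R := 𝔸)) * H y) := by
    rw [sato_equation hreg hdress hF hH (hS y), smul_comm, X_pow_smul_mul_highPart k (hS y),
      neg_smul, ← smul_neg, neg_sub]
  have hder : H y * S' = σ.map (C (R := 𝔸)) * H' - H' * S y := by
    have hprod := hH.mul hS'
    simp only [hS] at hprod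
    rw [eq_sub_iff_add_eq', hprod.unique (hH.const_mul σ)]
  have hunit := isUnit_det_of_coeffMatrix_zero hdress.self_of_nhds.coeff_zero
  rw [← Matrix.nonsing_inv_mul_cancel_left _ ((X : 𝔸⟦X⟧) ^ k • S') hunit, Matrix.mul_smul, hder,
    ← Matrix.nonsing_inv_mul_cancel_left _ (κ • (S y * _ - _)) hunit]
  congr 1
  rw [smul_sub, ← Matrix.mul_smul, ← Matrix.smul_mul, hsato]
  simp only [Matrix.mul_smul, Matrix.smul_mul, ← smul_sub, Matrix.mul_sub, Matrix.sub_mul,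
    ← Matrix.mul_assoc, hS]
  simp only [Matrix.mul_assoc, hS]
  congr 1
  abel

end DressingFlow

section LaxMatrix

variable {K : Type*} [CommRing K] {ι : Type*} [Fintype ι] [DecidableEq ι] {H : Matrix ι ι K⟦X⟧}

/-- The conjugate `S = H⁻¹ σ H` of the constant matrix `σ` by a dressing matrix `H`. -/
def laxMatrix (σ : Matrix ι ι K) (H : Matrix ι ι K⟦X⟧) : Matrix ι ι K⟦X⟧ :=
  H⁻¹ * (σ.map (C (R := K)) * H)

theorem mul_laxMatrix (hH : coeffMatrix 0 H = 1) (σ : Matrix ι ι K) :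
    H * laxMatrix σ H = σ.map (C (R := K)) * H :=
  Matrix.mul_nonsing_inv_cancel_left _ _ (isUnit_det_of_coeffMatrix_zero hH)

theorem coeffMatrix_zero_laxMatrix (hH : coeffMatrix 0 H = 1) (σ : Matrix ι ι K) :
    coeffMatrix 0 (laxMatrix σ H) = σ := by
  have h := congrArg (coeffMatrix 0) (mul_laxMatrix hH σ)
  rwa [coeffMatrix_zero_mul, coeffMatrix_map_C_mul, hH, Matrix.one_mul, Matrix.mul_one] at h

theorem coeffMatrix_one_laxMatrix (hH : coeffMatrix 0 H = 1) (σ : Matrix ι ι K) :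
    coeffMatrix 1 (laxMatrix σ H) = σ * coeffMatrix 1 H - coeffMatrix 1 H * σ := by
  have h := congrArg (coeffMatrix 1) (mul_laxMatrix hH σ)
  rw [coeffMatrix_one_mul, coeffMatrix_map_C_mul, hH, Matrix.one_mul,
    coeffMatrix_zero_laxMatrix hH] at h
  exact eq_sub_of_add_eq h

theorem laxMatrix_mul_self (hH : coeffMatrix 0 H = 1) {σ : Matrix ι ι K} (hσ : σ * σ = 1) :
    laxMatrix σ H * laxMatrix σ H = 1 := by
  have hσ' : σ.map (C (R := K)) * σ.map (C (R := K)) = 1 := by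
    rw [← Matrix.map_mul, hσ, Matrix.map_one _ (map_zero _) (map_one _)]
  have hunit := isUnit_det_of_coeffMatrix_zero hH
  calc laxMatrix σ H * laxMatrix σ H
      = H⁻¹ * (σ.map (C (R := K)) * (H * laxMatrix σ H)) := by
        simp only [laxMatrix, Matrix.mul_assoc]
    _ = H⁻¹ * ((σ.map (C (R := K)) * σ.map (C (R := K))) * H) := by
        rw [mul_laxMatrix hH, Matrix.mul_assoc]
    _ = 1 := by rw [hσ', Matrix.one_mul, Matrix.nonsing_inv_mul _ hunit]

theorem trace_laxMatrix (hH : coeffMatrix 0 H = 1) (σ : Matrix ι ι K) :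
    (laxMatrix σ H).trace = C σ.trace := by
  rw [laxMatrix, Matrix.trace_mul_comm, Matrix.mul_assoc,
    Matrix.mul_nonsing_inv _ (isUnit_det_of_coeffMatrix_zero hH), Matrix.mul_one]
  simp [Matrix.trace]

end LaxMatrix

section BlockKrylov

variable {K : Type*} [Field K] {ν ι κ : Type*} {p : ℕ} (e : ι × Fin p ≃ ν) (s : ι → K)

/-- The polynomial matrix without constant term whose coefficients of degrees `1, …, p` are read
off the block vector `w`, in such a way that `krylovSeries A F * ofBlockVec e s w` has `p`-th
coefficient `blockKrylov e s A F * w`. -/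
def ofBlockVec (w : Matrix ν κ K) : Matrix ι κ K⟦X⟧ :=
  .of fun a b => .mk fun d =>
    if h : 0 < d ∧ d ≤ p then s a ^ (p - d) * w (e (a, ⟨p - d, by omega⟩)) b else 0

theorem coeffMatrix_zero_ofBlockVec (w : Matrix ν κ K) :
    coeffMatrix 0 (ofBlockVec e s w) = 0 := by
  ext a b
  simp [coeffMatrix_apply, ofBlockVec]

theorem degreeLE_ofBlockVec (w : Matrix ν κ K) : DegreeLE p (ofBlockVec e s w) := fun d hd => by
  ext a b
  simp [coeffMatrix_apply, ofBlockVec, hd.not_ge]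

theorem coeffMatrix_ofBlockVec (w : Matrix ν κ K) (a : ι) (b : κ) (j : Fin p) :
    coeffMatrix (p - j) (ofBlockVec e s w) a b = s a ^ (j : ℕ) * w (e (a, j)) b := by
  have hj : p - (p - (j : ℕ)) = j := by omega
  rw [coeffMatrix_apply, ofBlockVec, Matrix.of_apply, coeff_mk, dif_pos (by omega)]
  simp only [hj]

variable [Fintype ν] [DecidableEq ν] (A : Matrix ν ν K) (F : Matrix ν ι K)

/-- The square matrix whose column `e (a, j)` is `s a ^ j • A ^ j *ᵥ F a`, that is, the `j`-th
derivative of the column `F a` under the flow `F' = A F diag(s)`. -/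
def blockKrylov : Matrix ν ν K :=
  .of fun i v => s (e.symm v).1 ^ ((e.symm v).2 : ℕ) *
    (A ^ ((e.symm v).2 : ℕ) * F) i (e.symm v).1

section Regularity

variable [Fintype ι]

theorem coeffMatrix_krylovSeries_mul_eq_blockKrylov_mul {Z : Matrix ι κ K⟦X⟧} {w : Matrix ν κ K}
    (hZ : coeffMatrix 0 Z = 0)
    (hw : ∀ a b (j : Fin p), coeffMatrix (p - j) Z a b = s a ^ (j : ℕ) * w (e (a, j)) b) :
    coeffMatrix p (krylovSeries A F * Z) = blockKrylov e s A F * w := by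
  ext i b
  rw [coeffMatrix_krylovSeries_mul, Finset.Nat.sum_antidiagonal_eq_sum_range_succ
    (f := fun c d => A ^ c * F * coeffMatrix d Z), Finset.sum_range_succ, Nat.sub_self, hZ,
    Matrix.mul_zero, add_zero, Finset.sum_range, Matrix.sum_apply, Matrix.mul_apply,
    ← e.sum_comp, Fintype.sum_prod_type_right]
  refine Finset.sum_congr rfl fun j _ => ?_
  rw [Matrix.mul_apply]
  refine Finset.sum_congr rfl fun a _ => ?_
  rw [hw, blockKrylov, Matrix.of_apply, Equiv.symm_apply_apply]
  ring

theorem coeffMatrix_krylovSeries_mul_ofBlockVec (w : Matrix ν κ K) :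
    coeffMatrix p (krylovSeries A F * ofBlockVec e s w) = blockKrylov e s A F * w :=
  coeffMatrix_krylovSeries_mul_eq_blockKrylov_mul e s A F (coeffMatrix_zero_ofBlockVec e s w)
    (coeffMatrix_ofBlockVec e s w)

variable {e s A F}

theorem isKrylovRegular_of_det_blockKrylov_ne_zero (hs : ∀ a, s a ≠ 0)
    (hdet : (blockKrylov e s A F).det ≠ 0) : IsKrylovRegular A F p := by
  intro Z hZ0 hZp hZ
  let w : Matrix ν ι K := .of fun v b =>
    (s (e.symm v).1 ^ ((e.symm v).2 : ℕ))⁻¹ * coeffMatrix (p - (e.symm v).2) Z (e.symm v).1 b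
  have hw : ∀ a b (j : Fin p), coeffMatrix (p - j) Z a b = s a ^ (j : ℕ) * w (e (a, j)) b :=
    fun a b j => by
      simp only [w, Matrix.of_apply, Equiv.symm_apply_apply]
      rw [mul_inv_cancel_left₀ (pow_ne_zero _ (hs a))]
  have hw0 : w = 0 := by
    rw [coeffMatrix_krylovSeries_mul_eq_blockKrylov_mul e s A F hZ0 hw] at hZ
    rw [← Matrix.nonsing_inv_mul_cancel_left _ w (isUnit_iff_ne_zero.mpr hdet), hZ,
      Matrix.mul_zero]
  refine ext_coeffMatrix fun d => ?_
  rw [map_zero]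
  rcases d.eq_zero_or_pos with rfl | hd
  · exact hZ0
  rcases lt_or_ge p d with hpd | hpd
  · exact hZp d hpd
  ext a b
  have := hw a b ⟨p - d, by omega⟩
  rwa [hw0, Matrix.zero_apply, mul_zero, Nat.sub_sub_self hpd] at this

theorem det_blockKrylov_ne_zero_of_isKrylovRegular (hs : ∀ a, s a ≠ 0)
    (hreg : IsKrylovRegular A F p) : (blockKrylov e s A F).det ≠ 0 := fun hdet => by
  obtain ⟨v, hv, hMv⟩ := Matrix.exists_mulVec_eq_zero_iff.mpr hdet
  have hZ : ofBlockVec e s (.of fun i (_ : ι) => v i) = 0 := by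
    refine hreg _ (coeffMatrix_zero_ofBlockVec e s _) (degreeLE_ofBlockVec e s _) ?_
    rw [coeffMatrix_krylovSeries_mul_ofBlockVec]
    ext i _
    exact congrFun hMv i
  refine hv (funext fun i => ?_)
  have := coeffMatrix_ofBlockVec e s (.of fun i (_ : ι) => v i) (e.symm i).1 (e.symm i).1
    (e.symm i).2
  simpa [hZ, hs] using this

end Regularity

variable [DecidableEq ι]

/-- The dressing matrix of `(A, F)`, computed by solving its linear system. -/
def dressing : Matrix ι ι K⟦X⟧ :=
  1 + ofBlockVec e s (-((blockKrylov e s A F)⁻¹ * (A ^ p * F)))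

theorem coeffMatrix_zero_dressing : coeffMatrix 0 (dressing e s A F) = 1 := by
  rw [dressing, map_add, coeffMatrix_zero_ofBlockVec, coeffMatrix_one, if_pos rfl, add_zero]

theorem coeffMatrix_one_dressing (a b : ι) (j : Fin p) (hj : (j : ℕ) + 1 = p) :
    coeffMatrix 1 (dressing e s A F) a b =
      -(s a ^ (j : ℕ) * (((blockKrylov e s A F).updateCol (e (a, j))
        (fun i => (A ^ p * F) i b)).det / (blockKrylov e s A F).det)) := by
  have h1 : 1 = p - (j : ℕ) := by omega
  rw [dressing, map_add, Matrix.add_apply, coeffMatrix_one, if_neg one_ne_zero,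
    Matrix.zero_apply, zero_add, h1, coeffMatrix_ofBlockVec, Matrix.neg_apply, mul_neg,
    Matrix.inv_def, Matrix.smul_mul, Matrix.smul_apply, Ring.inverse_eq_inv', smul_eq_mul,
    div_eq_inv_mul, ← Matrix.cramer_apply, Matrix.cramer_eq_adjugate_mulVec]
  rfl

variable {e s A F}

theorem isDressing_dressing [Fintype ι] (hdet : (blockKrylov e s A F).det ≠ 0) :
    IsDressing A F p (dressing e s A F) where
  coeff_zero := coeffMatrix_zero_dressing e s A F
  degreeLE := by
    refine DegreeLE.add (fun d hd => ?_) (degreeLE_ofBlockVec e s _)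
    rw [coeffMatrix_one, if_neg (by omega)]
  coeff_krylovSeries_mul := by
    rw [dressing, Matrix.mul_add, map_add, coeffMatrix_krylovSeries_mul_ofBlockVec,
      Matrix.mul_neg, Matrix.mul_nonsing_inv_cancel_left _ _ (isUnit_iff_ne_zero.mpr hdet),
      Matrix.mul_one, coeffMatrix_krylovSeries, add_neg_cancel]

end BlockKrylov

section DressingSmoothness

variable {𝕜 𝔸 : Type*} [NontriviallyNormedField 𝕜] [NormedField 𝔸] [NormedAlgebra 𝕜 𝔸]
  {ν ι : Type*} [Fintype ν] [DecidableEq ν]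

theorem contDiff_det {R : Type*} [NormedCommRing R] [NormedAlgebra 𝕜 R] {N : WithTop ℕ∞} :
    ContDiff 𝕜 N fun M : ν → ν → R => (Matrix.of M).det := by
  simp only [Matrix.det_apply', Matrix.of_apply]
  exact ContDiff.sum fun σ _ => contDiff_const.mul
    (contDiff_prod fun i _ => contDiff_apply_apply 𝕜 R (σ i) i)

theorem differentiableAt_det {M : 𝕜 → Matrix ν ν 𝔸} {y : 𝕜}
    (hM : ∀ i j, DifferentiableAt 𝕜 (fun z => M z i j) y) :
    DifferentiableAt 𝕜 (fun z => (M z).det) y :=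
  (contDiff_det.differentiable one_ne_zero _).comp y
    (differentiableAt_pi.mpr fun i => differentiableAt_pi.mpr (hM i))

theorem differentiableAt_inv_apply {M : 𝕜 → Matrix ν ν 𝔸} {y : 𝕜}
    (hM : ∀ i j, DifferentiableAt 𝕜 (fun z => M z i j) y) (hdet : (M y).det ≠ 0) (i j : ν) :
    DifferentiableAt 𝕜 (fun z => (M z)⁻¹ i j) y := by
  simp only [Matrix.inv_def, Ring.inverse_eq_inv', Matrix.smul_apply, smul_eq_mul,
    Matrix.adjugate_apply]
  refine ((differentiableAt_det hM).fun_inv hdet).fun_mul (differentiableAt_det fun k l => ?_)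
  simp only [Matrix.updateRow_apply]
  split_ifs
  · exact differentiableAt_const _
  · exact hM k l

variable {p : ℕ} {e : ι × Fin p ≃ ν} {s : ι → 𝔸} {A : Matrix ν ν 𝔸} {F : 𝕜 → Matrix ν ι 𝔸}
  {y : 𝕜}

theorem differentiableAt_blockKrylov (hF : ∀ i a, DifferentiableAt 𝕜 (fun z => F z i a) y)
    (i v : ν) : DifferentiableAt 𝕜 (fun z => blockKrylov e s A (F z) i v) y := by
  simp only [blockKrylov, Matrix.of_apply, Matrix.mul_apply]
  exact (DifferentiableAt.fun_sum fun j _ => (hF j _).const_mul _).const_mul _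

theorem eventually_isDressing [Fintype ι] [DecidableEq ι]
    (hF : ∀ i a, DifferentiableAt 𝕜 (fun z => F z i a) y)
    (hdet : (blockKrylov e s A (F y)).det ≠ 0) :
    ∀ᶠ z in 𝓝 y, IsDressing A (F z) p (dressing e s A (F z)) :=
  ((differentiableAt_det (differentiableAt_blockKrylov hF)).continuousAt.eventually_ne hdet).mono
    fun _ => isDressing_dressing

theorem exists_hasCoeffDerivAt_dressing [DecidableEq ι]
    (hF : ∀ i a, DifferentiableAt 𝕜 (fun z => F z i a) y)
    (hdet : (blockKrylov e s A (F y)).det ≠ 0) :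
    ∃ H', HasCoeffDerivAt (fun z => dressing e s A (F z)) H' y := by
  have hdiff : ∀ d a b,
      DifferentiableAt 𝕜 (fun z => coeffMatrix d (dressing e s A (F z)) a b) y := by
    intro d a b
    simp only [dressing, map_add, Matrix.add_apply]
    refine (differentiableAt_const _).fun_add ?_
    simp only [coeffMatrix_apply, ofBlockVec, Matrix.of_apply, coeff_mk]
    split_ifs
    · simp only [Matrix.neg_apply, Matrix.mul_apply (M := (blockKrylov e s A _)⁻¹)]
      refine (DifferentiableAt.fun_neg (DifferentiableAt.fun_sum fun i _ =>
        (differentiableAt_inv_apply (differentiableAt_blockKrylov hF) hdet _ i).fun_mul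
          ?_)).const_mul _
      simp only [Matrix.mul_apply]
      exact DifferentiableAt.fun_sum fun k _ => (hF k b).const_mul _
    · exact differentiableAt_const _
  refine ⟨.of fun a b => .mk fun d =>
    deriv (fun z => coeffMatrix d (dressing e s A (F z)) a b) y, fun d a b => ?_⟩
  rw [coeffMatrix_apply d (.of _), Matrix.of_apply, coeff_mk]
  exact (hdiff d a b).hasDerivAt

end DressingSmoothness

section DressedFlow

variable {𝕜 𝔸 : Type*} [NontriviallyNormedField 𝕜] [NormedField 𝔸] [NormedAlgebra 𝕜 𝔸]
  {ν ι : Type*} [Fintype ν] [DecidableEq ν] [Fintype ι] [DecidableEq ι]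
  {p : ℕ} {e : ι × Fin p ≃ ν} {s : ι → 𝔸} {A : Matrix ν ν 𝔸} {F : 𝕜 → Matrix ν ι 𝔸}
  {σ : Matrix ι ι 𝔸} {κ : 𝔸} {k : ℕ} {y : 𝕜}

theorem hasDerivAt_coeffMatrix_one_dressing (hs : ∀ a, s a ≠ 0)
    (hdet : (blockKrylov e s A (F y)).det ≠ 0)
    (hF : ∀ i a, HasDerivAt (fun z => F z i a) (((κ • A ^ k) * F y * σ) i a) y) (a b : ι) :
    HasDerivAt (fun z => coeffMatrix 1 (dressing e s A (F z)) a b)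
      (-κ * coeffMatrix (k + 1) (laxMatrix σ (dressing e s A (F y))) a b) y := by
  have hdiff : ∀ i a, DifferentiableAt 𝕜 (fun z => F z i a) y :=
    fun i a => (hF i a).differentiableAt
  have hreg := isKrylovRegular_of_det_blockKrylov_ne_zero hs hdet
  have hdress := eventually_isDressing hdiff hdet
  obtain ⟨H', hH⟩ := exists_hasCoeffDerivAt_dressing hdiff hdet
  have hsato := coeffMatrix_one_sato_equation hreg hdress hF hH
    (mul_laxMatrix (coeffMatrix_zero_dressing e s A (F y)) σ)
  refine (hH 1 a b).congr_deriv ?_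
  rw [hsato, Matrix.smul_apply, smul_eq_mul]

theorem hasDerivAt_coeffMatrix_laxMatrix_dressing (hs : ∀ a, s a ≠ 0)
    (hdet : (blockKrylov e s A (F y)).det ≠ 0)
    (hF : ∀ i a, HasDerivAt (fun z => F z i a) (((κ • A ^ k) * F y * σ) i a) y) (d : ℕ) (a b : ι) :
    let S := fun z => laxMatrix σ (dressing e s A (F z))
    HasDerivAt (fun z => coeffMatrix d (S z) a b)
      (κ * coeffMatrix (d + k) (S y * lowPart k (S y) - lowPart k (S y) * S y) a b) y := by
  intro S
  have hdiff : ∀ i a, DifferentiableAt 𝕜 (fun z => F z i a) y :=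
    fun i a => (hF i a).differentiableAt
  have hmul : ∀ z, dressing e s A (F z) * S z = σ.map (C (R := 𝔸)) * dressing e s A (F z) :=
    fun z => mul_laxMatrix (coeffMatrix_zero_dressing e s A (F z)) σ
  have hreg := isKrylovRegular_of_det_blockKrylov_ne_zero hs hdet
  have hdress := eventually_isDressing hdiff hdet
  obtain ⟨H', hH⟩ := exists_hasCoeffDerivAt_dressing hdiff hdet
  obtain ⟨S', hS'⟩ := hH.exists_of_mul_eq (hH.const_mul σ)
    (fun z => coeffMatrix_zero_dressing e s A (F z)) hmul
  have hlax := lax_equation hreg hdress hF hH hS' hmul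
  have hcoeff := congrArg (coeffMatrix (d + k)) hlax
  rw [coeffMatrix_add_X_pow_smul, map_smul] at hcoeff
  refine (hS' d a b).congr_deriv ?_
  rw [hcoeff, Matrix.smul_apply, smul_eq_mul]

end DressedFlow

section TwoComponents

theorem det_eq_of_move_col {R : Type*} [CommRing R] {N : ℕ}
    {P Q : Matrix (Fin (N + 1)) (Fin (N + 1)) R} {c d : Fin (N + 1)} (hcol : ∀ i, P i c = Q i d)
    (hrest : ∀ i (j : Fin N), P i (c.succAbove j) = Q i (d.succAbove j)) :
    P.det = (-1) ^ ((c : ℕ) + d) * Q.det := by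
  have hd : (-1 : R) ^ (d : ℕ) * (-1) ^ (d : ℕ) = 1 := by rw [← mul_pow]; simp
  rw [Matrix.det_succ_column P c, Matrix.det_succ_column Q d, Finset.mul_sum]
  refine Finset.sum_congr rfl fun i _ => ?_
  have hminor : P.submatrix i.succAbove c.succAbove = Q.submatrix i.succAbove d.succAbove := by
    ext a b
    exact hrest _ _
  rw [hminor, hcol, pow_add, pow_add, pow_add]
  linear_combination -((-1) ^ (i : ℕ) * (-1) ^ (c : ℕ) * Q i d *
    (Q.submatrix i.succAbove d.succAbove).det) * hd

variable {K : Type*} [Field K]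

/-- The matrix with columns `φ, Aφ, …, A ^ (p - 1) φ, ψ, -Aψ, (-A) ^ 2 ψ, …`, where `φ` and `ψ` are
the columns of `F`. Its determinant is a double Wronskian. -/
def doubleKrylov {N : ℕ} (p : ℕ) (A : Matrix (Fin N) (Fin N) K) (F : Matrix (Fin N) (Fin 2) K) :
    Matrix (Fin N) (Fin N) K :=
  .of fun i j => if (j : ℕ) < p then (A ^ (j : ℕ) * F) i 0
    else (-1) ^ ((j : ℕ) - p) * (A ^ ((j : ℕ) - p) * F) i 1

theorem det_updateCol_doubleKrylov {N : ℕ} (A : Matrix (Fin (N + 1)) (Fin (N + 1)) K)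
    (F : Matrix (Fin (N + 1)) (Fin 2) K) (p : Fin (N + 1)) (v : Fin (N + 1) → K) :
    ((doubleKrylov (p + 1) A F).updateCol p v).det =
      (-1) ^ ((p : ℕ) + N) * ((doubleKrylov p A F).updateCol (Fin.last N) v).det := by
  refine det_eq_of_move_col (d := Fin.last N)
    (fun i => by rw [Matrix.updateCol_self, Matrix.updateCol_self]) fun i j => ?_
  rw [Matrix.updateCol_ne (Fin.succAbove_ne _ _), Matrix.updateCol_ne (Fin.succAbove_ne _ _),
    Fin.succAbove_last]
  simp only [doubleKrylov, Matrix.of_apply, Fin.val_castSucc]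
  rcases lt_or_ge (j : ℕ) p with h | h
  · rw [Fin.succAbove_of_castSucc_lt _ _ h, if_pos h, Fin.val_castSucc, if_pos (by omega)]
  · rw [Fin.succAbove_of_le_castSucc _ _ h, if_neg h.not_gt, Fin.val_succ, if_neg (by omega),
      Nat.add_sub_add_right]

/-- The two halves of the index set `Fin (2 * n + 2)`. -/
def halves (n : ℕ) : Fin 2 × Fin (n + 1) ≃ Fin (2 * n + 2) := finProdFinEquiv

theorem halves_val {n : ℕ} (a : Fin 2) (j : Fin (n + 1)) :
    (halves n (a, j) : ℕ) = j + (n + 1) * a := rfl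

/-- The diagonal of the Pauli matrix `σ₃`. -/
def pauliSign : Fin 2 → K := ![1, -1]

theorem pauliSign_ne_zero (a : Fin 2) : (pauliSign a : K) ≠ 0 := by
  fin_cases a <;> simp [pauliSign]

variable {n : ℕ} (A : Matrix (Fin (2 * n + 2)) (Fin (2 * n + 2)) K)
  (F : Matrix (Fin (2 * n + 2)) (Fin 2) K)

theorem blockKrylov_halves :
    blockKrylov (halves n) pauliSign A F = doubleKrylov (n + 1) A F := by
  ext i v
  obtain ⟨⟨a, j⟩, rfl⟩ := (halves n).surjective v
  rw [blockKrylov, doubleKrylov, Matrix.of_apply, Matrix.of_apply, Equiv.symm_apply_apply]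
  fin_cases a
  · simp [pauliSign, halves_val, Fin.is_le]
  · simp [pauliSign, halves_val, show ¬ (j : ℕ) + (n + 1) ≤ n by omega]

theorem det_updateCol_halves_one :
    ((doubleKrylov (n + 1) A F).updateCol (halves n (1, Fin.last n))
      fun i => (A ^ (n + 1) * F) i 0).det = (-1) ^ n * (doubleKrylov (n + 2) A F).det := by
  have hlast : halves n (1, Fin.last n) = Fin.last (2 * n + 1) :=
    Fin.ext (by rw [halves_val, Fin.val_last, Fin.val_last, Fin.val_one]; omega)
  let m : Fin (2 * n + 2) := ⟨n + 1, by omega⟩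
  have hcol : (fun i => (A ^ (n + 1) * F) i 0) = fun i => doubleKrylov (n + 2) A F i m := by
    ext i
    simp [doubleKrylov, m]
  have hmove := det_updateCol_doubleKrylov A F m fun i => doubleKrylov (n + 2) A F i m
  rw [Matrix.updateCol_eq_self] at hmove
  rw [hmove, hlast, hcol, ← mul_assoc, ← pow_add,
    show n + (n + 1 + (2 * n + 1)) = 2 * (2 * n + 1) by ring, (even_two_mul _).neg_one_pow, one_mul]

theorem det_updateCol_halves_zero :
    ((doubleKrylov (n + 1) A F).updateCol (halves n (0, Fin.last n))
      fun i => (A ^ (n + 1) * F) i 1).det = (doubleKrylov n A F).det := by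
  let m : Fin (2 * n + 2) := ⟨n, by omega⟩
  have hm : halves n (0, Fin.last n) = m :=
    Fin.ext (by rw [halves_val, Fin.val_last, Fin.val_zero, mul_zero, add_zero])
  have hcol : (fun i => doubleKrylov n A F i (Fin.last (2 * n + 1))) =
      (-1 : K) ^ (n + 1) • fun i => (A ^ (n + 1) * F) i 1 := by
    ext i
    have hn : 2 * n + 1 - n = n + 1 := by omega
    simp [doubleKrylov, hn, show ¬ 2 * n + 1 < n by omega]
  have hlast := Matrix.updateCol_eq_self (doubleKrylov n A F) (Fin.last (2 * n + 1))
  rw [hcol] at hlast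
  rw [hm, det_updateCol_doubleKrylov A F m, ← congrArg Matrix.det hlast,
    Matrix.det_updateCol_smul]
  congr 1
  rw [show (m : ℕ) + (2 * n + 1) = 2 * n + (n + 1) by simp only [m]; ring, pow_add,
    (even_two_mul n).neg_one_pow, one_mul]

/-- The dressing matrix of the two-column Krylov data `(A, F)`. -/
def doubleDressing : Matrix (Fin 2) (Fin 2) K⟦X⟧ := dressing (halves n) pauliSign A F

/-- The conjugate of `σ₃` by `doubleDressing A F`. -/
def doubleLax : Matrix (Fin 2) (Fin 2) K⟦X⟧ :=
  laxMatrix (.diagonal pauliSign) (doubleDressing A F)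

theorem coeffMatrix_zero_doubleDressing : coeffMatrix 0 (doubleDressing A F) = 1 :=
  coeffMatrix_zero_dressing ..

theorem coeffMatrix_one_doubleDressing_one_zero :
    coeffMatrix 1 (doubleDressing A F) 1 0 =
      -((doubleKrylov (n + 2) A F).det / (doubleKrylov (n + 1) A F).det) := by
  have hsign : (-1 : K) ^ n * (-1) ^ n = 1 := by rw [← mul_pow]; simp
  rw [doubleDressing, coeffMatrix_one_dressing _ _ _ _ _ _ (Fin.last n) (Fin.val_last n ▸ rfl),
    blockKrylov_halves, det_updateCol_halves_one, Fin.val_last, mul_div_assoc, ← mul_assoc]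
  change -((-1) ^ n * (-1) ^ n * _) = _
  rw [hsign, one_mul]

theorem coeffMatrix_one_doubleDressing_zero_one :
    coeffMatrix 1 (doubleDressing A F) 0 1 =
      -((doubleKrylov n A F).det / (doubleKrylov (n + 1) A F).det) := by
  rw [doubleDressing, coeffMatrix_one_dressing _ _ _ _ _ _ (Fin.last n) (Fin.val_last n ▸ rfl),
    blockKrylov_halves, det_updateCol_halves_zero]
  change -(1 ^ _ * _) = _
  rw [one_pow, one_mul]

theorem coeffMatrix_one_doubleLax_apply (a b : Fin 2) :
    coeffMatrix 1 (doubleLax A F) a b =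
      (pauliSign a - pauliSign b) * coeffMatrix 1 (doubleDressing A F) a b := by
  rw [doubleLax, coeffMatrix_one_laxMatrix (coeffMatrix_zero_doubleDressing A F),
    Matrix.sub_apply, Matrix.diagonal_mul, Matrix.mul_diagonal]
  ring

theorem doubleLax_one_one : doubleLax A F 1 1 = -doubleLax A F 0 0 := by
  have h := trace_laxMatrix (coeffMatrix_zero_doubleDressing A F) (.diagonal pauliSign)
  simp only [Matrix.trace_diagonal, Matrix.trace_fin_two, Fin.sum_univ_two] at h
  simp only [pauliSign, Matrix.cons_val_zero, Matrix.cons_val_one, add_neg_cancel, map_zero] at h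
  exact eq_neg_of_add_eq_zero_right h

theorem doubleLax_mul_self : doubleLax A F * doubleLax A F = 1 := by
  refine laxMatrix_mul_self (coeffMatrix_zero_doubleDressing A F) ?_
  rw [Matrix.diagonal_mul_diagonal, ← Matrix.diagonal_one]
  congr 1
  ext a
  fin_cases a <;> simp [pauliSign]

end TwoComponents

section TwoComponentFlows

variable {𝕜 𝔸 : Type*} [NontriviallyNormedField 𝕜] [NormedField 𝔸] [NormedAlgebra 𝕜 𝔸] {n : ℕ}
  {A : Matrix (Fin (2 * n + 2)) (Fin (2 * n + 2)) 𝔸}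
  {F : 𝕜 → Matrix (Fin (2 * n + 2)) (Fin 2) 𝔸} {y : 𝕜}

theorem hasDerivAt_coeffMatrix_one_doubleLax {κ : 𝔸} {k : ℕ}
    (hdet : (doubleKrylov (n + 1) A (F y)).det ≠ 0)
    (hF : ∀ i a, HasDerivAt (fun z => F z i a)
      (pauliSign a * κ * (A ^ k * F y) i a) y) (a b : Fin 2) :
    HasDerivAt (fun z => coeffMatrix 1 (doubleLax A (F z)) a b)
      ((pauliSign b - pauliSign a) * κ * coeffMatrix (k + 1) (doubleLax A (F y)) a b) y := by
  rw [← blockKrylov_halves] at hdet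
  simp only [coeffMatrix_one_doubleLax_apply]
  refine ((hasDerivAt_coeffMatrix_one_dressing (σ := .diagonal pauliSign) (κ := κ) (k := k)
    pauliSign_ne_zero hdet (fun i a => (hF i a).congr_deriv ?_) a b).const_mul
      (pauliSign a - pauliSign b)).congr_deriv ?_
  · rw [Matrix.mul_diagonal, Matrix.smul_mul, Matrix.smul_apply, smul_eq_mul]
    ring
  · rw [doubleLax, doubleDressing]
    ring

theorem hasDerivAt_coeffMatrix_doubleLax (hdet : (doubleKrylov (n + 1) A (F y)).det ≠ 0)
    (hF : ∀ i a, HasDerivAt (fun z => F z i a)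
      (pauliSign a * (A * F y) i a) y) (j : ℕ) (a b : Fin 2) :
    HasDerivAt (fun z => coeffMatrix j (doubleLax A (F z)) a b)
      (coeffMatrix (j + 1) (doubleLax A (F y) * lowPart 1 (doubleLax A (F y)) -
        lowPart 1 (doubleLax A (F y)) * doubleLax A (F y)) a b) y := by
  rw [← blockKrylov_halves] at hdet
  refine (hasDerivAt_coeffMatrix_laxMatrix_dressing (κ := 1) (k := 1) pauliSign_ne_zero hdet
    (fun i a => (hF i a).congr_deriv ?_) j a b).congr_deriv ?_
  · rw [Matrix.mul_diagonal, one_smul, pow_one, mul_comm]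
  · rw [one_mul]
    rfl

end TwoComponentFlows

section DressedPotentials

variable {n : ℕ} {A : Matrix (Fin (2 * n + 2)) (Fin (2 * n + 2)) ℂ}
  {F : ℝ → Matrix (Fin (2 * n + 2)) (Fin 2) ℂ}

theorem isLaxSolution_doubleLax {U : Set ℝ}
    (hdet : ∀ y ∈ U, (doubleKrylov (n + 1) A (F y)).det ≠ 0)
    (hF : ∀ y ∈ U, ∀ i a, HasDerivAt (fun z => F z i a)
      (pauliSign a * (A * F y) i a) y) :
    IsLaxSolution U (fun y => coeffMatrix 1 (doubleLax A (F y)) 1 0)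
      (fun y => coeffMatrix 1 (doubleLax A (F y)) 0 1) (fun y => doubleLax A (F y) 0 0)
      (fun y => doubleLax A (F y) 1 0) (fun y => doubleLax A (F y) 0 1) := by
  have h0 : ∀ y, coeffMatrix 0 (doubleLax A (F y)) = .diagonal pauliSign := fun y =>
    coeffMatrix_zero_laxMatrix (coeffMatrix_zero_doubleDressing A (F y)) _
  have h1 : ∀ y a, coeffMatrix 1 (doubleLax A (F y)) a a = 0 := fun y a => by
    rw [coeffMatrix_one_doubleLax_apply, sub_self, zero_mul]
  have hneg : ∀ y d,
      coeffMatrix d (doubleLax A (F y)) 1 1 = -coeffMatrix d (doubleLax A (F y)) 0 0 := by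
    intro y d
    rw [coeffMatrix_apply, doubleLax_one_one, map_neg, coeffMatrix_apply]
  refine ⟨fun y _ => congrFun₂ (h0 y) 0 0, fun y _ => congrFun₂ (h0 y) 1 0,
    fun y _ => congrFun₂ (h0 y) 0 1, fun y _ => ?_, fun y hy j => ?_, fun y hy j => ?_⟩
  · have := congrFun₂ (doubleLax_mul_self A (F y)) 0 0
    rwa [Matrix.mul_apply, Fin.sum_univ_two, mul_comm (doubleLax A (F y) 0 1)] at this
  all_goals
    refine (hasDerivAt_coeffMatrix_doubleLax (hdet y hy) (hF y hy) j _ _).congr_deriv ?_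
    simp only [coeffMatrix_succ_mul_lowPart_one_sub, Matrix.add_apply, Matrix.sub_apply, h0,
      Matrix.mul_diagonal, Matrix.diagonal_mul]
    simp only [Matrix.mul_apply, Fin.sum_univ_two, h1, hneg]
    simp only [pauliSign, coeffMatrix_apply, Matrix.cons_val_zero, Matrix.cons_val_one]
    ring

end DressedPotentials

section MatrixExponential

open scoped Matrix.Norms.Operator

variable {ν : Type*} [Fintype ν] [DecidableEq ν]

theorem iteratedDeriv_apply_of_hasDerivAt_mulVec {𝕜 𝔸 : Type*} [NontriviallyNormedField 𝕜]
    [NormedCommRing 𝔸] [NormedAlgebra 𝕜 𝔸] {B : Matrix ν ν 𝔸} {Φ : 𝕜 → ν → 𝔸}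
    (h : ∀ y, HasDerivAt Φ (B *ᵥ Φ y) y) (j : ℕ) (i : ν) :
    iteratedDeriv j (fun y => Φ y i) = fun y => (B ^ j *ᵥ Φ y) i := by
  induction j with
  | zero => simp
  | succ j ih =>
    ext y
    have hsum : HasDerivAt (fun z => (B ^ j *ᵥ Φ z) i) ((B ^ j *ᵥ (B *ᵥ Φ y)) i) y :=
      HasDerivAt.fun_sum fun l _ => (hasDerivAt_pi.mp (h y) l).const_mul _
    rw [iteratedDeriv_succ, ih, hsum.deriv, Matrix.mulVec_mulVec, pow_succ]

/-- `M ↦ M *ᵥ v` as a continuous linear map. -/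
def mulVecCLM (v : ν → ℂ) : Matrix ν ν ℂ →L[ℝ] (ν → ℂ) :=
  ((Matrix.mulVecBilin ℝ ℝ).flip v).toContinuousLinearMap

theorem hasDerivAt_exp_smul_add_mulVec {A B : Matrix ν ν ℂ} (h : Commute A B) (v : ν → ℂ)
    (x : ℝ) :
    HasDerivAt (fun t : ℝ => NormedSpace.exp (t • A + B) *ᵥ v)
      (A *ᵥ (NormedSpace.exp (x • A + B) *ᵥ v)) x := by
  have hmul : ∀ t : ℝ, NormedSpace.exp (t • A + B) = NormedSpace.exp (t • A) * NormedSpace.exp B :=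
    fun t => Matrix.exp_add_of_commute _ _ (h.smul_left t)
  have hexp : HasDerivAt (fun t : ℝ => NormedSpace.exp (t • A + B))
      (A * NormedSpace.exp (x • A + B)) x := by
    simp only [hmul, ← mul_assoc]
    exact (hasDerivAt_exp_smul_const' (𝕂 := ℝ) A x).mul_const (NormedSpace.exp B)
  rw [Matrix.mulVec_mulVec]
  exact (mulVecCLM v).hasFDerivAt.comp_hasDerivAt x hexp

theorem contDiff_exp_mulVec {E : Type*} [NormedAddCommGroup E] [NormedSpace ℝ E]
    {f : E → Matrix ν ν ℂ} (hf : ContDiff ℝ ∞ f) (v : ν → ℂ) :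
    ContDiff ℝ ∞ fun e => NormedSpace.exp (f e) *ᵥ v :=
  (mulVecCLM v).contDiff.comp <| (contDiff_iff_contDiffAt.mpr fun M =>
    (NormedSpace.exp_analytic (𝕂 := ℝ) M).contDiffAt).comp hf

end MatrixExponential

section Waves

open scoped Matrix.Norms.Operator

variable {N : ℕ}

/-- The wave `exp(s (A x + ∑ A ^ (2 j) t_{2j})) v`: it is `φ` for `s = 1` and `ψ` for `s = -1`. -/
def wave (A : Matrix (Fin N) (Fin N) ℂ) (s : ℂ) (v : Fin N → ℂ) (t : ℕ → ℂ) (x : ℝ) : Fin N → ℂ :=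
  NormedSpace.exp (s • exponent A t x) *ᵥ v

theorem wave_one (A : Matrix (Fin N) (Fin N) ℂ) (C : Fin N → ℂ) : wave A 1 C = phi A C := by
  ext t x : 2
  rw [wave, one_smul, phi]

theorem wave_neg_one (A : Matrix (Fin N) (Fin N) ℂ) (D : Fin N → ℂ) :
    wave A (-1) D = psi A D := by
  ext t x : 2
  rw [wave, neg_one_smul, psi]

theorem commute_tsum_smul_pow (A : Matrix (Fin N) (Fin N) ℂ) (t : ℕ → ℂ) :
    Commute A (∑' j : ℕ, t (j + 1) • A ^ (2 * (j + 1))) :=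
  Commute.tsum_right A fun j => ((Commute.refl A).pow_right _).smul_right (t (j + 1))

theorem hasDerivAt_wave (A : Matrix (Fin N) (Fin N) ℂ) (s : ℂ) (v : Fin N → ℂ) (t : ℕ → ℂ)
    (x : ℝ) : HasDerivAt (wave A s v t) ((s • A) *ᵥ wave A s v t x) x := by
  have hcomm := ((commute_tsum_smul_pow A t).smul_left s).smul_right s
  have := hasDerivAt_exp_smul_add_mulVec hcomm v x
  simp only [smul_comm _ s A, ← smul_add, ← Complex.coe_smul] at this
  exact this

variable {A : Matrix (Fin N) (Fin N) ℂ} {τ : ℕ → ℝ}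

/-- The factor in `t_{2k} = timeFactor k * τ_{2k}`. -/
def timeFactor (k : ℕ) : ℂ := -((2 : ℂ) ^ (2 * k) / 2) * Complex.I

theorem exponent_update (hτ : Summable fun j : ℕ => times τ (j + 1) • A ^ (2 * (j + 1))) {k : ℕ}
    (hk : 1 ≤ k) (u x : ℝ) :
    exponent A (times (Function.update τ k u)) x =
      u • (timeFactor k • A ^ (2 * k)) +
        (exponent A (times τ) x - τ k • (timeFactor k • A ^ (2 * k))) := by
  obtain ⟨k, rfl⟩ := Nat.exists_eq_add_of_le' hk
  have hterm : ∀ j, times (Function.update τ (k + 1) u) (j + 1) • A ^ (2 * (j + 1)) =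
      times τ (j + 1) • A ^ (2 * (j + 1)) +
        Pi.single (M := fun _ => Matrix (Fin N) (Fin N) ℂ) k
          ((u - τ (k + 1)) • (timeFactor (k + 1) • A ^ (2 * (k + 1)))) j := by
    intro j
    by_cases hj : j = k
    · subst hj
      rw [Pi.single_eq_same, times, times, Function.update_self, timeFactor, ← Complex.coe_smul,
        smul_smul, ← add_smul]
      congr 1
      push_cast
      ring
    · rw [Pi.single_eq_of_ne hj, add_zero, times, times,
        Function.update_of_ne (by simpa using hj)]
  rw [exponent, exponent, tsum_congr hterm, hτ.tsum_add ⟨_, hasSum_pi_single _ _⟩, tsum_pi_single,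
    sub_smul]
  abel

theorem hasDerivAt_wave_time (hτ : Summable fun j : ℕ => times τ (j + 1) • A ^ (2 * (j + 1)))
    {k : ℕ} (hk : 1 ≤ k) (s : ℂ) (v : Fin N → ℂ) (x : ℝ) :
    HasDerivAt (fun u => wave A s v (times (Function.update τ k u)) x)
      ((s • timeFactor k • A ^ (2 * k)) *ᵥ wave A s v (times τ) x) (τ k) := by
  have hA : Commute (A ^ (2 * k)) (exponent A (times τ) x) :=
    (((Commute.refl A).smul_right _).add_right (commute_tsum_smul_pow A _)).pow_left _
  have hcomm : Commute (timeFactor k • A ^ (2 * k))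
      (exponent A (times τ) x - τ k • (timeFactor k • A ^ (2 * k))) :=
    (hA.smul_left _).sub_right ((Commute.refl _).smul_right _)
  have := hasDerivAt_exp_smul_add_mulVec ((hcomm.smul_left s).smul_right s) v (τ k)
  simp only [smul_comm _ s (timeFactor k • _), ← smul_add, ← exponent_update hτ hk,
    Function.update_eq_self] at this
  exact this

theorem contDiff_wave (hτ : Summable fun j : ℕ => times τ (j + 1) • A ^ (2 * (j + 1))) {k : ℕ}
    (hk : 1 ≤ k) (s : ℂ) (v : Fin N → ℂ) :
    ContDiff ℝ ∞ fun p : ℝ × ℝ => wave A s v (times (Function.update τ k p.2)) p.1 := by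
  refine contDiff_exp_mulVec ?_ v
  simp only [exponent_update hτ hk]
  simp only [exponent, Complex.coe_smul]
  exact (contDiff_const (c := s)).smul <| (contDiff_snd.smul contDiff_const).add
    (((contDiff_fst.smul contDiff_const).add contDiff_const).sub contDiff_const)

end Waves

section DoubleWronskians

variable {N : ℕ} (A : Matrix (Fin N) (Fin N) ℂ) (C D : Fin N → ℂ) (τ : ℕ → ℝ)

/-- The matrix with columns `φ` and `ψ`. -/
def waveMatrix (x : ℝ) : Matrix (Fin N) (Fin 2) ℂ :=
  .of fun i a => wave A (pauliSign a) (![C, D] a) (times τ) x i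

theorem W_eq_det_doubleKrylov (p : ℕ) (x : ℝ) :
    W A C D p τ x = (doubleKrylov p A (waveMatrix A C D τ x)).det := by
  rw [W, doubleWronskian, doubleKrylov, ← wave_one, ← wave_neg_one]
  simp only [iteratedDeriv_apply_of_hasDerivAt_mulVec (hasDerivAt_wave A _ _ _), smul_pow,
    one_smul, Matrix.smul_mulVec, Pi.smul_apply, smul_eq_mul]
  rfl

theorem hasDerivAt_waveMatrix (x : ℝ) (i : Fin N) (a : Fin 2) :
    HasDerivAt (fun y => waveMatrix A C D τ y i a)
      (pauliSign a * (A * waveMatrix A C D τ x) i a) x := by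
  refine (hasDerivAt_pi.mp (hasDerivAt_wave A _ _ _ x) i).congr_deriv ?_
  rw [Matrix.smul_mulVec]
  rfl

variable {A τ}

theorem hasDerivAt_waveMatrix_time
    (hτ : Summable fun j : ℕ => times τ (j + 1) • A ^ (2 * (j + 1))) {k : ℕ} (hk : 1 ≤ k)
    (x : ℝ) (i : Fin N) (a : Fin 2) :
    HasDerivAt (fun u => waveMatrix A C D (Function.update τ k u) x i a)
      (pauliSign a * timeFactor k * (A ^ (2 * k) * waveMatrix A C D τ x) i a) (τ k) := by
  refine (hasDerivAt_pi.mp (hasDerivAt_wave_time hτ hk _ _ x) i).congr_deriv ?_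
  rw [smul_smul, Matrix.smul_mulVec]
  rfl

theorem contDiff_W (hτ : Summable fun j : ℕ => times τ (j + 1) • A ^ (2 * (j + 1))) {k : ℕ}
    (hk : 1 ≤ k) (p : ℕ) :
    ContDiff ℝ ∞ fun e : ℝ × ℝ => W A C D p (Function.update τ k e.2) e.1 := by
  have hF : ∀ i a, ContDiff ℝ ∞ fun e : ℝ × ℝ =>
      waveMatrix A C D (Function.update τ k e.2) e.1 i a := fun i a =>
    contDiff_pi.mp (contDiff_wave hτ hk _ _) i
  simp only [W_eq_det_doubleKrylov]
  refine contDiff_det.comp (contDiff_pi.mpr fun i => contDiff_pi.mpr fun j => ?_)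
  change ContDiff ℝ ∞ fun e => ite _ _ _
  simp only [Matrix.mul_apply]
  split_ifs
  · exact ContDiff.sum fun l _ => contDiff_const.mul (hF l _)
  · exact contDiff_const.mul (ContDiff.sum fun l _ => contDiff_const.mul (hF l _))

theorem contDiff_W_space (hτ : Summable fun j : ℕ => times τ (j + 1) • A ^ (2 * (j + 1)))
    (p : ℕ) : ContDiff ℝ ∞ (W A C D p τ) := by
  have := (contDiff_W C D hτ le_rfl p).comp (contDiff_id.prodMk (contDiff_const (c := τ 1)))
  simpa only [Function.comp_def, Function.update_eq_self, id] using this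

end DoubleWronskians

section ConjugateDressing

variable {K : Type*} [CommRing K] {f : K →+* K} {ν ι : Type*}

theorem coeffMatrix_map (d : ℕ) (P : Matrix ν ι K⟦X⟧) :
    coeffMatrix d (P.map (PowerSeries.map f)) = (coeffMatrix d P).map f := by
  ext i j
  simp only [coeffMatrix_apply, Matrix.map_apply, PowerSeries.coeff_map]

theorem DegreeLE.map {d : ℕ} {P : Matrix ν ι K⟦X⟧} (hP : DegreeLE d P) :
    DegreeLE d (P.map (PowerSeries.map f)) := fun e he => by
  rw [coeffMatrix_map, hP e he, Matrix.map_zero _ (map_zero f)]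

variable [Fintype ν] [DecidableEq ν] {A T : Matrix ν ν K}

theorem mul_map_pow (hAT : A * T = T * A.map f) (j : ℕ) : T * (A ^ j).map f = A ^ j * T := by
  rw [show (A ^ j).map f = A.map f ^ j from map_pow f.mapMatrix A j]
  exact ((show SemiconjBy T (A.map f) A from hAT.symm).pow_right j).eq

variable [Fintype ι] {F F' : Matrix ν ι K} {J : Matrix ι ι K} {p : ℕ}

theorem coeffMatrix_krylovSeries_mul_map (hAT : A * T = T * A.map f)
    (hF : T * F'.map f = F * J) (d : ℕ) (Z : Matrix ι ι K⟦X⟧) :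
    coeffMatrix d (krylovSeries A F * (J.map (C (R := K)) * Z.map (PowerSeries.map f))) =
      T * (coeffMatrix d (krylovSeries A F' * Z)).map f := by
  have hsum : ∀ M : ℕ × ℕ → Matrix ν ι K, (∑ e ∈ antidiagonal d, M e).map f =
      ∑ e ∈ antidiagonal d, (M e).map f := fun M => map_sum f.toAddMonoidHom.mapMatrix M _
  rw [coeffMatrix_krylovSeries_mul, coeffMatrix_krylovSeries_mul, hsum, Matrix.mul_sum]
  refine Finset.sum_congr rfl fun e _ => ?_
  calc A ^ e.1 * F * coeffMatrix e.2 (J.map (C (R := K)) * Z.map (PowerSeries.map f))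
      = A ^ e.1 * (F * J) * (coeffMatrix e.2 Z).map f := by
        simp only [coeffMatrix_map_C_mul, coeffMatrix_map, Matrix.mul_assoc]
    _ = T * (A ^ e.1).map f * F'.map f * (coeffMatrix e.2 Z).map f := by
        rw [← hF, mul_map_pow hAT, ← Matrix.mul_assoc]
    _ = T * (A ^ e.1 * F' * coeffMatrix e.2 Z).map f := by
        simp only [Matrix.map_mul, Matrix.mul_assoc]

variable [DecidableEq ι]

theorem IsKrylovRegular.of_conjugate (hreg : IsKrylovRegular A F p) (hf : Function.Injective f)
    (hAT : A * T = T * A.map f) (hF : T * F'.map f = F * J) (hJ : IsUnit J.det) :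
    IsKrylovRegular A F' p := by
  intro Z hZ0 hZp hZ
  have hJZ : J.map (C (R := K)) * Z.map (PowerSeries.map f) = 0 := by
    refine hreg _ ?_ (hZp.map.map_C_mul J) ?_
    · rw [coeffMatrix_map_C_mul, coeffMatrix_map, hZ0, Matrix.map_zero _ (map_zero f),
        Matrix.mul_zero]
    · rw [coeffMatrix_krylovSeries_mul_map hAT hF, hZ, Matrix.map_zero _ (map_zero f),
        Matrix.mul_zero]
  refine ext_coeffMatrix fun d => ?_
  have hd := congrArg (coeffMatrix d) hJZ
  rw [coeffMatrix_map_C_mul, coeffMatrix_map, map_zero] at hd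
  rw [map_zero, ← (Matrix.map_injective hf).eq_iff, Matrix.map_zero _ (map_zero f),
    ← Matrix.nonsing_inv_mul_cancel_left _ (Matrix.map _ f) hJ, hd, Matrix.mul_zero]

theorem IsDressing.conjugate {H' : Matrix ι ι K⟦X⟧} (h' : IsDressing A F' p H')
    (hAT : A * T = T * A.map f) (hF : T * F'.map f = F * J) (hJ : IsUnit J.det) :
    IsDressing A F p
      (J.map (C (R := K)) * H'.map (PowerSeries.map f) * J⁻¹.map (C (R := K))) where
  coeff_zero := by
    rw [coeffMatrix_mul_map_C, coeffMatrix_map_C_mul, coeffMatrix_map, h'.coeff_zero,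
      Matrix.map_one _ (map_zero f) (map_one f), Matrix.mul_one, Matrix.mul_nonsing_inv _ hJ]
  degreeLE := (h'.degreeLE.map.map_C_mul J).mul_map_C J⁻¹
  coeff_krylovSeries_mul := by
    rw [← Matrix.mul_assoc, coeffMatrix_mul_map_C, coeffMatrix_krylovSeries_mul_map hAT hF,
      h'.coeff_krylovSeries_mul, Matrix.map_zero _ (map_zero f), Matrix.mul_zero, Matrix.zero_mul]

theorem IsDressing.coeffMatrix_mul_eq {H H' : Matrix ι ι K⟦X⟧} (h : IsDressing A F p H)
    (h' : IsDressing A F' p H') (hreg : IsKrylovRegular A F p) (hAT : A * T = T * A.map f)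
    (hF : T * F'.map f = F * J) (hJ : IsUnit J.det) (d : ℕ) :
    coeffMatrix d H * J = J * (coeffMatrix d H').map f := by
  rw [h.unique (h'.conjugate hAT hF hJ) hreg, coeffMatrix_mul_map_C, coeffMatrix_map_C_mul,
    coeffMatrix_map, Matrix.nonsing_inv_mul_cancel_right _ _ hJ]

end ConjugateDressing

section Reflection

variable {N : ℕ} {A T : Matrix (Fin N) (Fin N) ℂ} {C D : Fin N → ℂ} {δ : ℂ} {τ : ℕ → ℝ}

theorem star_mulVec_eq_map_star_mulVec (M : Matrix (Fin N) (Fin N) ℂ) (v : Fin N → ℂ) :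
    star (M *ᵥ v) = M.map star *ᵥ star v := by
  ext i
  simp [Matrix.mulVec, dotProduct]

theorem star_times (τ : ℕ → ℝ) (j : ℕ) : star (times τ j) = -times τ j := by
  simp [times]

theorem isUnit_of_mul_map_star (hδ : δ ≠ 0)
    (hT : T * T.map star = δ • (1 : Matrix (Fin N) (Fin N) ℂ)) : IsUnit T := by
  refine IsUnit.of_mul_eq_one (δ⁻¹ • T.map star) ?_
  rw [Matrix.mul_smul, hT, smul_smul, inv_mul_cancel₀ hδ, one_smul]

open scoped Matrix.Norms.Operator in
theorem map_star_exp (M : Matrix (Fin N) (Fin N) ℂ) :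
    (NormedSpace.exp M).map star = NormedSpace.exp (M.map star) :=
  NormedSpace.map_exp (starRingEnd ℂ).mapMatrix (continuous_id.matrix_map continuous_star) M

theorem mul_map_star_smul (c : ℂ) (M : Matrix (Fin N) (Fin N) ℂ) :
    T * (c • M).map star = star c • (T * M.map star) := by
  rw [← Matrix.mul_smul]
  congr 1
  ext i j
  simp

theorem mul_exponent_map_star (hAT : A * T = T * A.map star)
    (hτ : Summable fun j : ℕ => times τ (j + 1) • A ^ (2 * (j + 1))) (x : ℝ) :
    T * (exponent A (times τ) (-x)).map star = -(exponent A (times τ) x * T) := by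
  let g : Matrix (Fin N) (Fin N) ℂ →+ Matrix (Fin N) (Fin N) ℂ :=
    (AddMonoidHom.mulLeft T).comp (starRingEnd ℂ).toAddMonoidHom.mapMatrix
  have hg : Continuous g := continuous_const.matrix_mul (continuous_id.matrix_map continuous_star)
  have hpow : ∀ (c : ℂ) (j : ℕ), g (c • A ^ j) = star c • (A ^ j * T) := fun c j =>
    (mul_map_star_smul c (A ^ j)).trans
      (congrArg _ (mul_map_pow (f := starRingEnd ℂ) hAT j))
  have hspace : g (((-x : ℝ) : ℂ) • A) = -((x : ℂ) • A * T) := by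
    have := hpow ((-x : ℝ) : ℂ) 1
    rw [pow_one, Complex.star_def, Complex.conj_ofReal] at this
    rw [this, Complex.ofReal_neg, neg_smul, Matrix.smul_mul]
  change g (exponent A (times τ) (-x)) = _
  rw [exponent, exponent, map_add, hspace, hτ.map_tsum g hg, add_mul, ← hτ.tsum_mul_right,
    neg_add, ← tsum_neg]
  congr 1
  refine tsum_congr fun j => ?_
  rw [hpow, star_times, neg_smul, Matrix.smul_mul]

theorem mulVec_star_wave (hT : IsUnit T) (hAT : A * T = T * A.map star)
    (hτ : Summable fun j : ℕ => times τ (j + 1) • A ^ (2 * (j + 1))) (s : ℂ) (v : Fin N → ℂ)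
    (x : ℝ) :
    T *ᵥ star (wave A s v (times τ) (-x)) = wave A (-star s) (T *ᵥ star v) (times τ) x := by
  have hdet := (Matrix.isUnit_iff_isUnit_det T).mp hT
  have hE : (-star s) • exponent A (times τ) x =
      T * (s • exponent A (times τ) (-x)).map star * T⁻¹ := by
    rw [mul_map_star_smul, mul_exponent_map_star hAT hτ, smul_neg, Matrix.neg_mul,
      Matrix.smul_mul, Matrix.mul_nonsing_inv_cancel_right _ _ hdet, neg_smul]
  rw [wave, wave, hE, Matrix.exp_conj _ _ hT, star_mulVec_eq_map_star_mulVec, map_star_exp,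
    Matrix.mulVec_mulVec, Matrix.mulVec_mulVec, Matrix.nonsing_inv_mul_cancel_right _ _ hdet]

theorem psi_eq_mulVec_star_phi (hT : IsUnit T) (hAT : A * T = T * A.map star)
    (hD : D = T *ᵥ star C) (hτ : Summable fun j : ℕ => times τ (j + 1) • A ^ (2 * (j + 1)))
    (x : ℝ) : psi A D (times τ) x = T *ᵥ star (phi A C (times τ) (-x)) := by
  rw [← wave_one, mulVec_star_wave hT hAT hτ, star_one, wave_neg_one, hD]

theorem mul_map_star_waveMatrix (hδ : δ ≠ 0) (hAT : A * T = T * A.map star)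
    (hT : T * T.map star = δ • (1 : Matrix (Fin N) (Fin N) ℂ)) (hD : D = T *ᵥ star C)
    (hτ : Summable fun j : ℕ => times τ (j + 1) • A ^ (2 * (j + 1))) (x : ℝ) :
    T * (waveMatrix A C D τ (-x)).map star = waveMatrix A C D τ x * !![0, δ; 1, 0] := by
  have hwave := mulVec_star_wave (isUnit_of_mul_map_star hδ hT) hAT hτ
  have hC : T *ᵥ star D = δ • C := by
    rw [hD, star_mulVec_eq_map_star_mulVec, star_star, Matrix.mulVec_mulVec, hT,
      Matrix.smul_mulVec, Matrix.one_mulVec]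
  have hφ := hwave 1 C x
  have hψ := hwave (-1) D x
  rw [star_one, ← hD] at hφ
  rw [star_neg, star_one, neg_neg, hC, wave_one, phi, Matrix.mulVec_smul] at hψ
  ext i a
  fin_cases a
  · refine (congrFun hφ i).trans ?_
    simp [Matrix.mul_apply, waveMatrix, pauliSign]
  · refine (congrFun hψ i).trans ?_
    simp [Matrix.mul_apply, waveMatrix, pauliSign, wave, mul_comm]

end Reflection

section Solutions

variable {n : ℕ} (A : Matrix (Fin (2 * n + 2)) (Fin (2 * n + 2)) ℂ) (C D : Fin (2 * n + 2) → ℂ)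

theorem qSol_eq_coeffMatrix_doubleLax (τ : ℕ → ℝ) (x : ℝ) :
    qSol A C D τ x = coeffMatrix 1 (doubleLax A (waveMatrix A C D τ x)) 1 0 := by
  rw [coeffMatrix_one_doubleLax_apply, coeffMatrix_one_doubleDressing_one_zero, qSol,
    W_eq_det_doubleKrylov, W_eq_det_doubleKrylov]
  simp only [pauliSign, Matrix.cons_val_zero, Matrix.cons_val_one]
  ring

theorem rSol_eq_coeffMatrix_doubleLax (τ : ℕ → ℝ) (x : ℝ) :
    rSol A C D τ x = coeffMatrix 1 (doubleLax A (waveMatrix A C D τ x)) 0 1 := by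
  rw [coeffMatrix_one_doubleLax_apply, coeffMatrix_one_doubleDressing_zero_one, rSol,
    W_eq_det_doubleKrylov, W_eq_det_doubleKrylov]
  simp only [pauliSign, Matrix.cons_val_zero, Matrix.cons_val_one]
  ring

theorem contDiffAt_const_mul_div {E : Type*} [NormedAddCommGroup E] [NormedSpace ℝ E] (c : ℂ)
    {f g : E → ℂ} {x : E} (hf : ContDiff ℝ ∞ f) (hg : ContDiff ℝ ∞ g) (hx : g x ≠ 0) :
    ContDiffAt ℝ ∞ (fun e => c * f e / g e) x := by
  simp only [div_eq_mul_inv]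
  exact (contDiffAt_const.mul hf.contDiffAt).mul (hg.contDiffAt.inv hx)

variable {A C D} {τ : ℕ → ℝ} (hτ : Summable fun j : ℕ => times τ (j + 1) • A ^ (2 * (j + 1)))
include hτ

theorem contDiffAt_qSol {k : ℕ} (hk : 1 ≤ k) {x : ℝ} (hx : W A C D (n + 1) τ x ≠ 0) :
    ContDiffAt ℝ ∞ (fun p : ℝ × ℝ => qSol A C D (Function.update τ k p.2) p.1) (x, τ k) :=
  contDiffAt_const_mul_div 2 (contDiff_W C D hτ hk (n + 2)) (contDiff_W C D hτ hk (n + 1))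
    (by simpa using hx)

theorem coeffMatrix_doubleLax_waveMatrix {x : ℝ} (hx : W A C D (n + 1) τ x ≠ 0) (j : ℕ) :
    coeffMatrix j (doubleLax A (waveMatrix A C D τ x)) 1 0 =
      evalAt (laxCoeff j).2.1 (qSol A C D τ) (rSol A C D τ) x := by
  have hU : IsOpen {y | W A C D (n + 1) τ y ≠ 0} :=
    isOpen_ne_fun (contDiff_W_space C D hτ (n + 1)).continuous continuous_const
  have hlax := isLaxSolution_doubleLax (U := {y | W A C D (n + 1) τ y ≠ 0})
    (fun y hy => by rw [← W_eq_det_doubleKrylov]; exact hy)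
    fun y _ => hasDerivAt_waveMatrix A C D τ y
  simp only [← qSol_eq_coeffMatrix_doubleLax, ← rSol_eq_coeffMatrix_doubleLax] at hlax
  exact (hlax.coeff_eq_evalAt_laxCoeff hU
    (fun y hy => contDiffAt_const_mul_div 2 (contDiff_W_space C D hτ (n + 2))
      (contDiff_W_space C D hτ (n + 1)) hy)
    (fun y hy => contDiffAt_const_mul_div (-2) (contDiff_W_space C D hτ n)
      (contDiff_W_space C D hτ (n + 1)) hy) j x hx).2.1

theorem hasDerivAt_qSol_time {k : ℕ} (hk : 1 ≤ k) {x : ℝ} (hx : W A C D (n + 1) τ x ≠ 0) :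
    HasDerivAt (fun u => qSol A C D (Function.update τ k u) x)
      (2 * timeFactor k * evalAt (laxCoeff (2 * k + 1)).2.1 (qSol A C D τ) (rSol A C D τ) x)
      (τ k) := by
  have hdet := hx
  rw [W_eq_det_doubleKrylov, ← Function.update_eq_self k τ] at hdet
  have hflow := hasDerivAt_waveMatrix_time C D hτ hk x
  rw [← coeffMatrix_doubleLax_waveMatrix hτ hx]
  simp only [qSol_eq_coeffMatrix_doubleLax]
  have := hasDerivAt_coeffMatrix_one_doubleLax (A := A) (y := τ k) (κ := timeFactor k)
    (k := 2 * k) (F := fun u => waveMatrix A C D (Function.update τ k u) x) hdet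
    (by simpa only [Function.update_eq_self] using hflow) 1 0
  rw [Function.update_eq_self] at this
  refine this.congr_deriv ?_
  simp only [pauliSign, Matrix.cons_val_zero, Matrix.cons_val_one]
  ring

theorem solvesAt_qSol {ε : ℂ} {k : ℕ} (hk : 1 ≤ k) {x : ℝ} (hx : W A C D (n + 1) τ x ≠ 0)
    (hx' : W A C D (n + 1) τ (-x) ≠ 0)
    (hr : ∀ᶠ y in 𝓝 x, rSol A C D τ y = reflected ε (qSol A C D τ) y) :
    SolvesAt ε k (qSol A C D) τ x := by
  refine ⟨contDiffAt_qSol hτ hk hx, contDiffAt_qSol hτ hk hx', ?_⟩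
  have hflow : nlsFlow ε k (qSol A C D τ) x =
      -evalAt (aknsFlow (2 * k)).1 (qSol A C D τ) (rSol A C D τ) x := by
    simp only [nlsFlow, evalAt, Filter.EventuallyEq.iteratedDeriv_eq _ hr]
  rw [(hasDerivAt_qSol_time hτ hk hx).deriv, hflow, aknsFlow_eq]
  simp only [evalAt, map_neg, MvPolynomial.smul_eval, neg_neg, timeFactor]
  rw [(even_two_mul k).neg_pow]
  linear_combination (-(2 : ℂ) ^ (2 * k) * MvPolynomial.eval _ (laxCoeff (2 * k + 1)).2.1) *
    Complex.I_mul_I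

omit hτ

variable {T : Matrix (Fin (2 * n + 2)) (Fin (2 * n + 2)) ℂ} {δ : ℂ} {x : ℝ}
  (hδ : δ ≠ 0) (hAT : A * T = T * A.map star)
  (hF : T * (waveMatrix A C D τ (-x)).map star = waveMatrix A C D τ x * !![0, δ; 1, 0])
  (hx : W A C D (n + 1) τ x ≠ 0)
include hδ hAT hF hx

theorem W_neg_ne_zero : W A C D (n + 1) τ (-x) ≠ 0 := by
  rw [W_eq_det_doubleKrylov, ← blockKrylov_halves] at hx ⊢
  refine det_blockKrylov_ne_zero_of_isKrylovRegular pauliSign_ne_zero ?_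
  have hreg := isKrylovRegular_of_det_blockKrylov_ne_zero pauliSign_ne_zero hx
  exact hreg.of_conjugate (f := starRingEnd ℂ) star_injective hAT hF (by simpa using hδ)

theorem rSol_eq_star_qSol_neg : rSol A C D τ x = -δ * star (qSol A C D τ (-x)) := by
  have hx' := W_neg_ne_zero hδ hAT hF hx
  rw [W_eq_det_doubleKrylov, ← blockKrylov_halves] at hx hx'
  have hreg := isKrylovRegular_of_det_blockKrylov_ne_zero pauliSign_ne_zero hx
  have hH := (isDressing_dressing hx).coeffMatrix_mul_eq (isDressing_dressing hx') hreg
    (f := starRingEnd ℂ) hAT hF (by simpa using hδ) 1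
  have h01 := congrFun₂ hH 0 0
  simp only [Matrix.mul_apply, Fin.sum_univ_two, Matrix.map_apply, Matrix.of_apply,
    Matrix.cons_val_zero, Matrix.cons_val_one, mul_zero, zero_add, zero_mul, mul_one] at h01
  rw [rSol_eq_coeffMatrix_doubleLax, qSol_eq_coeffMatrix_doubleLax,
    coeffMatrix_one_doubleLax_apply, coeffMatrix_one_doubleLax_apply, doubleDressing,
    doubleDressing, h01, star_mul', starRingEnd_apply]
  simp only [pauliSign, Matrix.cons_val_zero, Matrix.cons_val_one, star_sub, star_neg, star_one]
  ring

end Solutions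

end NonlocalNLS

end

theorem theorem1_general (n : ℕ) (A T : Matrix (Fin (2 * n + 2)) (Fin (2 * n + 2)) ℂ)
    (C D : Fin (2 * n + 2) → ℂ) (δ : ℂ) (hδ : δ ≠ 0)
    (hAT : A * T = T * A.map star)
    (hT : T * T.map star = δ • (1 : Matrix (Fin (2 * n + 2)) (Fin (2 * n + 2)) ℂ))
    (hD : D = T.mulVec (star C))
    (τ : ℕ → ℝ)
    (hτ : Summable fun j : ℕ => NonlocalNLS.times τ (j + 1) • A ^ (2 * (j + 1))) :
    (∀ x : ℝ, NonlocalNLS.psi A D (NonlocalNLS.times τ) x =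
      T.mulVec (star (NonlocalNLS.phi A C (NonlocalNLS.times τ) (-x)))) ∧
    ∀ x : ℝ, NonlocalNLS.W A C D (n + 1) τ x ≠ 0 →
      NonlocalNLS.rSol A C D τ x = -δ * star (NonlocalNLS.qSol A C D τ (-x)) ∧
      ∀ k : ℕ, 1 ≤ k → NonlocalNLS.SolvesAt (-δ) k (NonlocalNLS.qSol A C D) τ x := by
  open NonlocalNLS in
  have hF := mul_map_star_waveMatrix hδ hAT hT hD hτ
  have hr : ∀ y, W A C D (n + 1) τ y ≠ 0 → rSol A C D τ y = reflected (-δ) (qSol A C D τ) y :=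
    fun y => rSol_eq_star_qSol_neg hδ hAT (hF y)
  have hcont : Continuous (W A C D (n + 1) τ) := (contDiff_W_space C D hτ (n + 1)).continuous
  refine ⟨psi_eq_mulVec_star_phi (isUnit_of_mul_map_star hδ hT) hAT hD hτ,
    fun x hx => ⟨hr x hx, fun k hk => ?_⟩⟩
  exact solvesAt_qSol hτ hk hx (W_neg_ne_zero hδ hAT (hF x) hx)
    ((hcont.continuousAt.eventually_ne hx).mono hr)

theorem theorem1 (n : ℕ) (A T : Matrix (Fin (2 * n + 2)) (Fin (2 * n + 2)) ℂ)
    (C D : Fin (2 * n + 2) → ℂ) (ε δ : ℂ)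
    (hsign : (ε = 1 ∧ δ = -1) ∨ (ε = -1 ∧ δ = 1))
    (hAT : A * T = T * A.map star)
    (hT : T * T.map star = δ • (1 : Matrix (Fin (2 * n + 2)) (Fin (2 * n + 2)) ℂ))
    (hD : D = T.mulVec (star C))
    (τ : ℕ → ℝ)
    (hτ : Summable fun j : ℕ => NonlocalNLS.times τ (j + 1) • A ^ (2 * (j + 1))) :
    (∀ x : ℝ, NonlocalNLS.psi A D (NonlocalNLS.times τ) x =
      T.mulVec (star (NonlocalNLS.phi A C (NonlocalNLS.times τ) (-x)))) ∧
    ∀ x : ℝ, NonlocalNLS.W A C D (n + 1) τ x ≠ 0 →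
      NonlocalNLS.rSol A C D τ x = ε * star (NonlocalNLS.qSol A C D τ (-x)) ∧
      ∀ k : ℕ, 1 ≤ k → NonlocalNLS.SolvesAt ε k (NonlocalNLS.qSol A C D) τ x := by
  have hδ : δ ≠ 0 := by rcases hsign with ⟨-, rfl⟩ | ⟨-, rfl⟩ <;> simp
  obtain rfl : ε = -δ := by rcases hsign with ⟨rfl, rfl⟩ | ⟨rfl, rfl⟩ <;> simp
  exact theorem1_general n A T C D δ hδ hAT hT hD τ hτ
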